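/- Theorem 1.2. Let $\rho=(\rho_1,\rho_2,\rho_3,\rho_4)$ with $0<\rho_i<1$, $\sum_i\rho_i<1$ and $\rho_1=\rho_4$. Let $D\subset\mathbb R$ be a dust-like self-similar set with contraction vector $\rho$, i.e. the nonempty compact set with $D=\bigcup_{i=1}^4\Phi_i(D)$ for some similitudes $\Phi_i$ of $\mathbb R$ with ratios $\rho_i$ such that the sets $\Phi_i(D)$ are pairwise disjoint. Let $T\subset\mathbb R$ be the attractor (the nonempty compact set with $T=\bigcup_{i=1}^4\Psi_i(T)$) of maps $\Psi_i(x)=\rho_i x+t_i$ such that the intervals $\Psi_1([0,1]),\dots,\Psi_4([0,1])$ are arranged from left to right without overlapping interiors, $\Psi_1(0)=0$, $\Psi_4(1)=1$, and the set of touching letters $\Sigma_T=\{\,i\in\{1,2,3\}:\Psi_i(1)=\Psi_{i+1}(0)\,\}$ equals $\{2\}$. Assume that $D\sim T$, i.e. that there are a bijection $f:D\to T$ and constants $c,c'>0$ with $c|x-y|\le|f(x)-f(y)|\le c'|x-y|$ for all $x,y\in D$. Then $D$ and $T$ have a common finite Hausdorff dimension $s$, and $\mu_2=\rho_2^s$ and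 $\mu_3=\rho_3^s$ are algebraically dependent over $\mathbb Q$: there is a nonzero polynomial $P(x,y)$ with rational coefficients such that $P(\mu_2,\mu_3)=0$. Consequently, the condition $\log\rho_1/\log\rho_n\in\mathbb Q$ is not sufficient for $D\sim T$ in general, even for $n=4$: there are $\rho$ (with $\rho_1=\rho_4$, so that $\log\rho_1/\log\rho_4=1\in\mathbb Q$) and $T$ with $\Sigma_T=\{2\}$ as above such that dust-like self-similar sets with contraction vector $\rho$ exist and none of them is Lipschitz equivalent to $T$. -/

import Mathlib

open scoped NNReal

/-- Two subsets of the line are Lipschitz equivalent if there is a bi-Lipschitz bijection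
from one onto the other. -/
def LipschitzEquivalent (E F : Set ℝ) : Prop :=
  ∃ f : ℝ → ℝ, Set.BijOn f E F ∧ ∃ c c' : ℝ, 0 < c ∧ 0 < c' ∧
    ∀ x ∈ E, ∀ y ∈ E, c * |x - y| ≤ |f x - f y| ∧ |f x - f y| ≤ c' * |x - y|

/-- A similitude of the line with ratio `r` (orientation may be preserved or reversed). -/
def IsSimilitude (r : ℝ) (φ : ℝ → ℝ) : Prop :=
  ∀ x y : ℝ, |φ x - φ y| = r * |x - y|

/-- `E` is the attractor of the iterated function system `Φ`: the nonempty compact set with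
`E = ⋃ i, Φ i (E)` (it is unique if the maps are contractions). -/
structure IsAttractor {n : ℕ} (Φ : Fin n → ℝ → ℝ) (E : Set ℝ) : Prop where
  nonempty : E.Nonempty
  isCompact : IsCompact E
  iUnion_image : ⋃ i, Φ i '' E = E

/-- A contraction vector in `ℝ`. -/
structure IsContractionVector {n : ℕ} (ρ : Fin n → ℝ) : Prop where
  pos : ∀ i, 0 < ρ i
  lt_one : ∀ i, ρ i < 1
  sum_lt_one : ∑ i, ρ i < 1

/-- `D` is a dust-like self-similar set in `ℝ` with contraction vector `ρ`: the attractor of an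
IFS of similitudes with ratios `ρ i` satisfying the strong separation condition. -/
def IsDustLike {n : ℕ} (ρ : Fin n → ℝ) (D : Set ℝ) : Prop :=
  ∃ Φ : Fin n → ℝ → ℝ, (∀ i, IsSimilitude (ρ i) (Φ i)) ∧ IsAttractor Φ D ∧
    ∀ i j, i ≠ j → Disjoint (Φ i '' D) (Φ j '' D)

/-- The maps `Ψ i (x) = ρ i * x + t i`. -/
def affineIFS {n : ℕ} (ρ t : Fin n → ℝ) (i : Fin n) (x : ℝ) : ℝ :=
  ρ i * x + t i

/-- The (left) touching letters: those `i` for which the interval `Ψ i ([0,1])` touches the next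
one, i.e. `Ψ i (1) = Ψ (i + 1) (0)`. Letters are numbered from `0` here. -/
def touchingLetters {n : ℕ} (ρ t : Fin n → ℝ) : Set (Fin n) :=
  {i | ∃ j : Fin n, j.val = i.val + 1 ∧ affineIFS ρ t i 1 = affineIFS ρ t j 0}

/-- The intervals `Ψ i ([0,1])` lie from left to right in `[0,1]` without overlapping, the first
one starts at `0`, the last one ends at `1`, and at least two neighbours touch. -/
structure IsTouchingIFS {n : ℕ} (ρ t : Fin n → ℝ) : Prop where
  ordered : ∀ i j : Fin n, i < j → affineIFS ρ t i 1 ≤ affineIFS ρ t j 0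
  left_end : ∀ i : Fin n, i.val = 0 → affineIFS ρ t i 0 = 0
  right_end : ∀ i : Fin n, i.val + 1 = n → affineIFS ρ t i 1 = 1
  touching : (touchingLetters ρ t).Nonempty

/-! Write `μ_i = ρ_i ^ s`, where `s` solves `∑ μ_i = 1`. Then `D` has positive finite
`s`-dimensional Hausdorff measure `H`, and bi-Lipschitz maps preserve this property, so `s` is the
dimension of `T` as well. Let `g : T → D` be bi-Lipschitz, and let `X` be the union of the two
touching parts of `T`.

Rigidity. Since `ρ₀ = ρ₃`, the parts of `X` adjacent to the touching point form a copy of `X` scaled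
by `ρ₀`, so `T` and `X` decompose into separated copies of each other (`exists_isGraphDirected`).
The pieces are isolated at their own scale. Hence `g` maps a piece and its parts to unions of
cylinders of bounded relative depth inside one common cylinder (`exists_cylinder_decomposition`).
The ratio `H(g(piece)) / H(piece)` is therefore multiplied by one of finitely many factors when
passing to a part. Being bounded, it is constant below some piece (`exists_ratio_constant`).

Contradiction. Suppose `μ₁, μ₂` are algebraically independent, so that relations between weights
become polynomial identities with `μ₀ = μ₃ = (1 - μ₁ - μ₂) / 2`. Copies of `X` shrinking to a
touching point have measures proportional to `μ₀ ^ k`. By pigeonhole two of their images, far apart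
in `k`, have the same relative shape `S`, so their cylinders differ by a word of weight `μ₀ ^ j`.
Such a word uses only the letters 0 and 3, and so does some word of `S` (`exists_word_of_nested`).
On the other hand, comparing a copy of `X` with the left half of the annulus around its touching
point shows that every word of `S` contains 1 or 2 (`exists_letter_of_dvd`).

For the counterexample, independent weights are prescribed and `ρ_i = μ_i ^ 2` is taken. -/

/-! ### Words and cylinders -/

section Words

variable {n : ℕ}

/-- The composition `Φ i₁ ∘ ⋯ ∘ Φ iₖ` along the word `i₁ … iₖ`. -/
def wordMap (Φ : Fin n → ℝ → ℝ) : List (Fin n) → ℝ → ℝ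
  | [] => id
  | i :: w => Φ i ∘ wordMap Φ w

/-- The product of weights along a word. -/
def wordProd {R : Type*} [CommMonoid R] (m : Fin n → R) (w : List (Fin n)) : R :=
  (w.map m).prod

/-- The cylinder of the word `w` in the attractor `D`. -/
def wordCylinder (Φ : Fin n → ℝ → ℝ) (D : Set ℝ) (w : List (Fin n)) : Set ℝ :=
  wordMap Φ w '' D

@[simp] lemma wordProd_nil {R : Type*} [CommMonoid R] (m : Fin n → R) : wordProd m [] = 1 := rfl

@[simp] lemma wordProd_cons {R : Type*} [CommMonoid R] (m : Fin n → R) (i : Fin n)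
    (w : List (Fin n)) : wordProd m (i :: w) = m i * wordProd m w := by simp [wordProd]

@[simp] lemma wordProd_append {R : Type*} [CommMonoid R] (m : Fin n → R) (u w : List (Fin n)) :
    wordProd m (u ++ w) = wordProd m u * wordProd m w := by simp [wordProd]

lemma map_wordProd {R S : Type*} [CommSemiring R] [CommSemiring S] (f : R →+* S) (m : Fin n → R)
    (w : List (Fin n)) : f (wordProd m w) = wordProd (fun i => f (m i)) w := by
  induction w with
  | nil => simp
  | cons i w ih => simp [ih]

lemma wordProd_pos {m : Fin n → ℝ} (hm : ∀ i, 0 < m i) (w : List (Fin n)) :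
    0 < wordProd m w := by
  induction w with
  | nil => simp
  | cons i w ih => simpa using mul_pos (hm i) ih

lemma wordProd_le_one {m : Fin n → ℝ} (hm : ∀ i, 0 < m i) (hm1 : ∀ i, m i ≤ 1)
    (w : List (Fin n)) : wordProd m w ≤ 1 := by
  induction w with
  | nil => simp
  | cons i w ih => simpa using mul_le_one₀ (hm1 i) (wordProd_pos hm w).le ih

lemma wordProd_le_pow {m : Fin n → ℝ} {r : ℝ} (hm : ∀ i, 0 < m i) (hr : ∀ i, m i ≤ r)
    (w : List (Fin n)) : wordProd m w ≤ r ^ w.length := by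
  induction w with
  | nil => simp
  | cons i w ih =>
    rw [wordProd_cons, List.length_cons, pow_succ']
    exact mul_le_mul (hr i) ih (wordProd_pos hm w).le ((hm i).le.trans (hr i))

lemma wordProd_rpow {m : Fin n → ℝ} (hm : ∀ i, 0 < m i) (s : ℝ) (w : List (Fin n)) :
    wordProd (fun i => m i ^ s) w = wordProd m w ^ s := by
  induction w with
  | nil => simp
  | cons i w ih => rw [wordProd_cons, wordProd_cons, ih,
      Real.mul_rpow (hm i).le (wordProd_pos hm w).le]

lemma wordMap_append (Φ : Fin n → ℝ → ℝ) (u w : List (Fin n)) :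
    wordMap Φ (u ++ w) = wordMap Φ u ∘ wordMap Φ w := by
  induction u with
  | nil => rfl
  | cons i u ih => simp [wordMap, ih, Function.comp_assoc]

lemma abs_wordMap_sub {ρ : Fin n → ℝ} {Φ : Fin n → ℝ → ℝ} (h : ∀ i, IsSimilitude (ρ i) (Φ i))
    (w : List (Fin n)) (x y : ℝ) :
    |wordMap Φ w x - wordMap Φ w y| = wordProd ρ w * |x - y| := by
  induction w with
  | nil => simp [wordMap]
  | cons i w ih => simp [wordMap, h i _ _, ih, mul_assoc]

lemma cylinder_append (Φ : Fin n → ℝ → ℝ) (D : Set ℝ) (u w : List (Fin n)) :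
    wordCylinder Φ D (u ++ w) = wordMap Φ u '' wordCylinder Φ D w := by
  rw [wordCylinder, wordCylinder, wordMap_append, Set.image_comp]

lemma cylinder_nil (Φ : Fin n → ℝ → ℝ) (D : Set ℝ) : wordCylinder Φ D [] = D := by
  simp [wordCylinder, wordMap]

/-- The data of a dust-like self-similar set: contracting similitudes and their attractor, with
the strong separation condition. -/
structure IsDustSystem (ρ : Fin n → ℝ) (Φ : Fin n → ℝ → ℝ) (D : Set ℝ) : Prop where
  pos : ∀ i, 0 < ρ i
  lt_one : ∀ i, ρ i < 1
  sim : ∀ i, IsSimilitude (ρ i) (Φ i)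
  attr : IsAttractor Φ D
  disj : ∀ i j, i ≠ j → Disjoint (Φ i '' D) (Φ j '' D)

namespace IsDustSystem

variable {ρ : Fin n → ℝ} {Φ : Fin n → ℝ → ℝ} {D : Set ℝ}

lemma exists_ratio_bound (h : IsDustSystem ρ Φ D) : ∃ r, 0 < r ∧ r < 1 ∧ ∀ i, ρ i ≤ r := by
  have hne : Nonempty (Fin n) := by
    obtain ⟨x, hx⟩ := h.attr.nonempty
    rw [← h.attr.iUnion_image] at hx
    obtain ⟨i, -⟩ := Set.mem_iUnion.1 hx
    exact ⟨i⟩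
  obtain ⟨i, hi⟩ := Finite.exists_max ρ
  exact ⟨ρ i, h.pos i, h.lt_one i, hi⟩

lemma image_subset (h : IsDustSystem ρ Φ D) (i : Fin n) : Φ i '' D ⊆ D :=
  (Set.subset_iUnion (fun i => Φ i '' D) i).trans h.attr.iUnion_image.subset

lemma cylinder_subset (h : IsDustSystem ρ Φ D) (w : List (Fin n)) : wordCylinder Φ D w ⊆ D := by
  induction w with
  | nil => simp [cylinder_nil]
  | cons i w ih =>
    rw [show i :: w = [i] ++ w from rfl, cylinder_append]
    exact (Set.image_mono ih).trans (h.image_subset i)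

lemma cylinder_append_subset (h : IsDustSystem ρ Φ D) (w u : List (Fin n)) :
    wordCylinder Φ D (w ++ u) ⊆ wordCylinder Φ D w := by
  rw [cylinder_append]
  exact Set.image_mono (h.cylinder_subset u)

lemma wordMap_injective (h : IsDustSystem ρ Φ D) (w : List (Fin n)) :
    Function.Injective (wordMap Φ w) := by
  intro x y hxy
  have := abs_wordMap_sub h.sim w x y
  rw [hxy, sub_self, abs_zero, eq_comm, mul_eq_zero] at this
  rcases this with h1 | h1
  · exact absurd h1 (wordProd_pos h.pos w).ne'
  · exact sub_eq_zero.1 (abs_eq_zero.1 h1)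

lemma wordMap_continuous (h : IsDustSystem ρ Φ D) (w : List (Fin n)) :
    Continuous (wordMap Φ w) := by
  refine (LipschitzWith.of_dist_le_mul (K := (wordProd ρ w).toNNReal) fun x y => ?_).continuous
  rw [Real.dist_eq, Real.dist_eq, abs_wordMap_sub h.sim,
    Real.coe_toNNReal _ (wordProd_pos h.pos w).le]

lemma isCompact_cylinder (h : IsDustSystem ρ Φ D) (w : List (Fin n)) :
    IsCompact (wordCylinder Φ D w) :=
  h.attr.isCompact.image (h.wordMap_continuous w)

lemma disjoint_cylinder (h : IsDustSystem ρ Φ D) {u w : List (Fin n)} (hl : u.length = w.length)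
    (hne : u ≠ w) : Disjoint (wordCylinder Φ D u) (wordCylinder Φ D w) := by
  induction u generalizing w with
  | nil => exact absurd (List.length_eq_zero_iff.1 hl.symm).symm hne
  | cons i u ih =>
    cases w with
    | nil => simp at hl
    | cons j w =>
      rw [show i :: u = [i] ++ u from rfl, show j :: w = [j] ++ w from rfl]
      by_cases hij : i = j
      · subst hij
        rw [cylinder_append, cylinder_append]
        exact (Set.disjoint_image_iff (h.wordMap_injective _)).2
          (ih (by simpa using hl) (by simpa using hne))
      · exact (h.disj i j hij).mono (h.cylinder_append_subset [i] u)
          (h.cylinder_append_subset [j] w)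

lemma exists_cylinder_cons (h : IsDustSystem ρ Φ D) {w : List (Fin n)} {x : ℝ}
    (hx : x ∈ wordCylinder Φ D w) : ∃ i, x ∈ wordCylinder Φ D (w ++ [i]) := by
  obtain ⟨y, hy, rfl⟩ := hx
  rw [← h.attr.iUnion_image] at hy
  obtain ⟨i, hi⟩ := Set.mem_iUnion.1 hy
  exact ⟨i, by rw [cylinder_append]; exact Set.mem_image_of_mem _ hi⟩

lemma exists_cylinder_append (h : IsDustSystem ρ Φ D) {w : List (Fin n)} {x : ℝ}
    (hx : x ∈ wordCylinder Φ D w) (L : ℕ) :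
    ∃ u : List (Fin n), u.length = L ∧ x ∈ wordCylinder Φ D (w ++ u) := by
  induction L with
  | zero => exact ⟨[], rfl, by simpa using hx⟩
  | succ L ih =>
    obtain ⟨u, hu, hxu⟩ := ih
    obtain ⟨i, hi⟩ := h.exists_cylinder_cons hxu
    exact ⟨u ++ [i], by simp [hu], by simpa using hi⟩

lemma exists_cylinder (h : IsDustSystem ρ Φ D) {x : ℝ} (hx : x ∈ D) (L : ℕ) :
    ∃ u : List (Fin n), u.length = L ∧ x ∈ wordCylinder Φ D u := by
  simpa using h.exists_cylinder_append (w := []) (by simpa [cylinder_nil] using hx) L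

/-- Two cylinders that meet are nested. -/
lemma isPrefix_of_mem (h : IsDustSystem ρ Φ D) {u w : List (Fin n)} {x : ℝ}
    (hl : u.length ≤ w.length) (hu : x ∈ wordCylinder Φ D u) (hw : x ∈ wordCylinder Φ D w) :
    ∃ z, w = u ++ z := by
  refine ⟨w.drop u.length, ?_⟩
  by_contra hne
  have h1 : x ∈ wordCylinder Φ D (w.take u.length) := by
    rw [← List.take_append_drop u.length w] at hw
    exact h.cylinder_append_subset _ _ hw
  have h2 : u ≠ w.take u.length := by
    intro he
    exact hne (by conv_lhs => rw [← List.take_append_drop u.length w, ← he])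
  exact Set.disjoint_left.1 (h.disjoint_cylinder (by simp [hl]) h2) hu h1

lemma exists_separation (h : IsDustSystem ρ Φ D) : ∃ δ, 0 < δ ∧ ∀ i j, i ≠ j →
    ∀ x ∈ Φ i '' D, ∀ y ∈ Φ j '' D, δ ≤ |x - y| := by
  have hc : ∀ i, IsCompact (Φ i '' D) := fun i => h.isCompact_cylinder [i]
  have key : ∀ q : Fin n × Fin n, ∃ δ : ℝ, 0 < δ ∧ (q.1 ≠ q.2 →
      ∀ x ∈ Φ q.1 '' D, ∀ y ∈ Φ q.2 '' D, δ ≤ |x - y|) := by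
    rintro ⟨i, j⟩
    by_cases hij : i = j
    -- The value 1 on the diagonal is a dummy; it lets the minimum run over all pairs.
    · exact ⟨1, one_pos, fun hne => absurd hij hne⟩
    · obtain ⟨r, hr, hd⟩ :=
        Metric.exists_pos_forall_lt_edist (hc i) (hc j).isClosed (h.disj i j hij)
      refine ⟨r, hr, fun _ x hx y hy => ?_⟩
      have := hd x hx y hy
      rw [edist_nndist, ENNReal.coe_lt_coe, ← NNReal.coe_lt_coe, coe_nndist, Real.dist_eq] at this
      exact this.le
  choose δ hδ hsep using key
  cases isEmpty_or_nonempty (Fin n × Fin n) with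
  | inl he => exact ⟨1, one_pos, fun i j => (he.false (i, j)).elim⟩
  | inr hne =>
    obtain ⟨q, hq⟩ := Finite.exists_min δ
    exact ⟨δ q, hδ q, fun i j hij x hx y hy => (hq (i, j)).trans (hsep (i, j) hij x hx y hy)⟩

lemma exists_diam_bound (h : IsDustSystem ρ Φ D) : ∃ d, 0 < d ∧ ∀ w, ∀ x ∈ wordCylinder Φ D w,
    ∀ y ∈ wordCylinder Φ D w, |x - y| ≤ wordProd ρ w * d := by
  obtain ⟨C, hC⟩ := Metric.isBounded_iff.1 h.attr.isCompact.isBounded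
  refine ⟨max C 1, by positivity, ?_⟩
  rintro w _ ⟨x, hx, rfl⟩ _ ⟨y, hy, rfl⟩
  rw [abs_wordMap_sub h.sim]
  exact mul_le_mul_of_nonneg_left ((hC hx hy).trans (le_max_left _ _)) (wordProd_pos h.pos w).le

/-- A nontrivial subset of `D` has a smallest cylinder containing it; it meets two of the
first-level subcylinders. -/
lemma exists_minimal_cylinder (h : IsDustSystem ρ Φ D) {δ : ℝ}
    (hδ : ∀ i j, i ≠ j → ∀ x ∈ Φ i '' D, ∀ y ∈ Φ j '' D, δ ≤ |x - y|) {A : Set ℝ}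
    (hA : A ⊆ D) (hne : A.Nontrivial) : ∃ w, A ⊆ wordCylinder Φ D w ∧
      ∃ x ∈ A, ∃ y ∈ A, wordProd ρ w * δ ≤ |x - y| := by
  classical
  -- Cylinder diameters shrink geometrically, so some level has no cylinder containing `A`. The word
  -- `w` is taken one level above the first such level.
  have hex : ∃ k : ℕ, ∀ w : List (Fin n), w.length = k → ¬ A ⊆ wordCylinder Φ D w := by
    obtain ⟨x, hx, y, hy, hxy⟩ := hne
    obtain ⟨d, hd, hdiam⟩ := h.exists_diam_bound
    obtain ⟨r, hr0, hr1, hr⟩ := h.exists_ratio_bound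
    obtain ⟨k, hk⟩ := exists_pow_lt_of_lt_one (div_pos (abs_pos.2 (sub_ne_zero.2 hxy)) hd) hr1
    refine ⟨k, fun w hw hAw => ?_⟩
    have h1 := hdiam w x (hAw hx) y (hAw hy)
    have h2 := wordProd_le_pow h.pos hr w
    rw [hw] at h2
    rw [lt_div_iff₀ hd] at hk
    nlinarith
  have hk := Nat.find_spec hex
  obtain ⟨k, hk'⟩ : ∃ k, Nat.find hex = k + 1 := Nat.exists_eq_succ_of_ne_zero fun h0 => by
    rw [h0] at hk
    exact hk [] rfl (by rwa [cylinder_nil])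
  have hmin := Nat.find_min hex (m := k) (by omega)
  push Not at hmin
  obtain ⟨w, hw, hAw⟩ := hmin
  refine ⟨w, hAw, ?_⟩
  obtain ⟨x, hx⟩ := hne.nonempty
  obtain ⟨i, hi⟩ := h.exists_cylinder_cons (hAw hx)
  rw [hk'] at hk
  obtain ⟨y, hy, hyi⟩ := Set.not_subset.1 (hk (w ++ [i]) (by simp [hw]))
  obtain ⟨j, hj⟩ := h.exists_cylinder_cons (hAw hy)
  refine ⟨x, hx, y, hy, ?_⟩
  have hij : i ≠ j := by rintro rfl; exact hyi hj
  rw [cylinder_append] at hi hj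
  obtain ⟨x', hx', rfl⟩ := hi
  obtain ⟨y', hy', rfl⟩ := hj
  rw [abs_wordMap_sub h.sim]
  exact mul_le_mul_of_nonneg_left (hδ i j hij x' hx' y' hy') (wordProd_pos h.pos w).le

/-- A subset of a cylinder that is isolated in `D` at a scale comparable to the cylinder is a
union of subcylinders of bounded depth. -/
lemma eq_iUnion_cylinder (h : IsDustSystem ρ Φ D) {r d η : ℝ} (hr : ∀ i, ρ i ≤ r)
    (hd : ∀ w, ∀ x ∈ wordCylinder Φ D w, ∀ y ∈ wordCylinder Φ D w, |x - y| ≤ wordProd ρ w * d)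
    (hd0 : 0 < d) {w : List (Fin n)} {A : Set ℝ} (hA : A ⊆ wordCylinder Φ D w)
    (hiso : ∀ x ∈ A, ∀ y ∈ D \ A, wordProd ρ w * η ≤ |x - y|) {L : ℕ} (hL : r ^ L * d < η) :
    ∃ S : Finset (List.Vector (Fin n) L), A = ⋃ u ∈ S, wordCylinder Φ D (w ++ u.1) := by
  classical
  refine ⟨Finset.univ.filter fun u => wordCylinder Φ D (w ++ u.1) ⊆ A, ?_⟩
  apply Set.Subset.antisymm
  · intro x hx
    obtain ⟨u, hu, hxu⟩ := h.exists_cylinder_append (hA hx) L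
    simp only [Finset.mem_filter, Finset.mem_univ, true_and, Set.mem_iUnion]
    refine ⟨⟨u, hu⟩, fun y hy => ?_, hxu⟩
    -- A subcylinder at depth `L` has diameter below the isolation distance, so it cannot meet both
    -- `A` and `D \ A`.
    by_contra hyA
    have h1 := hiso x hx y ⟨h.cylinder_subset _ hy, hyA⟩
    have h2 := hd _ x hxu y hy
    have h3 := wordProd_le_pow h.pos hr u
    have hw := wordProd_pos h.pos w
    rw [hu] at h3
    simp only [wordProd_append] at h2
    have h4 : wordProd ρ w * (wordProd ρ u * d) < wordProd ρ w * η := by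
      apply mul_lt_mul_of_pos_left _ hw
      exact (mul_le_mul_of_nonneg_right h3 hd0.le).trans_lt hL
    linarith
  · intro x hx
    simp only [Finset.mem_filter, Finset.mem_univ, true_and, Set.mem_iUnion] at hx
    obtain ⟨u, hu, hxu⟩ := hx
    exact hu hxu

end IsDustSystem

end Words

/-! ### Coding maps, and the Hausdorff measure of a dust-like set -/

section Coding

open MeasureTheory Filter Topology

variable {n : ℕ}

/-- The point reached from `x₀` by applying the first `k` maps coded by `ω`. -/
def codeApprox (Φ : Fin n → ℝ → ℝ) (x₀ : ℝ) : ℕ → (ℕ → Fin n) → ℝ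
  | 0, _ => x₀
  | k + 1, ω => Φ (ω 0) (codeApprox Φ x₀ k fun j => ω (j + 1))

/-- The approximations are Cauchy at a geometric rate independent of the code, so their limit is
uniform and hence continuous. Its range supplies attractors, and it pushes Bernoulli measures
forward to `D`. -/
lemma exists_codingMap (Φ : Fin n → ℝ → ℝ) {r : ℝ} (hr0 : 0 ≤ r) (hr1 : r < 1)
    (hΦ : ∀ i x y, |Φ i x - Φ i y| ≤ r * |x - y|) {K : Set ℝ} (hK : IsClosed K)
    (hKne : K.Nonempty) (hmaps : ∀ i, Set.MapsTo (Φ i) K K) :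
    ∃ π : (ℕ → Fin n) → ℝ, Continuous π ∧ (∀ ω, π ω ∈ K) ∧
      ∀ ω, π ω = Φ (ω 0) (π fun j => ω (j + 1)) := by
  obtain ⟨x₀, hx₀⟩ := hKne
  have hcont : ∀ i, Continuous (Φ i) := fun i =>
    (LipschitzWith.of_dist_le_mul (K := r.toNNReal) fun x y => by
      rw [Real.dist_eq, Real.dist_eq, Real.coe_toNNReal _ hr0]; exact hΦ i x y).continuous
  have hmem : ∀ k ω, codeApprox Φ x₀ k ω ∈ K := by
    intro k
    induction k with
    | zero => exact fun ω => hx₀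
    | succ k ih => exact fun ω => hmaps _ (ih _)
  have hapc : ∀ k, Continuous (codeApprox Φ x₀ k) := by
    intro k
    induction k with
    | zero => exact continuous_const
    | succ k ih =>
      have h1 : Continuous fun q : Fin n × ℝ => Φ q.1 q.2 :=
        continuous_prod_of_discrete_left.2 hcont
      have h2 : Continuous fun ω : ℕ → Fin n =>
          (ω 0, codeApprox Φ x₀ k fun j => ω (j + 1)) := by
        refine (continuous_apply 0).prodMk (ih.comp ?_)
        exact continuous_pi fun j => continuous_apply (j + 1)
      exact h1.comp h2
  obtain ⟨C, hC⟩ : ∃ C : ℝ, ∀ i, |x₀ - Φ i x₀| ≤ C := by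
    obtain ⟨C, hC⟩ := (Set.finite_range fun i => |x₀ - Φ i x₀|).bddAbove
    exact ⟨C, fun i => hC ⟨i, rfl⟩⟩
  have hstep : ∀ k ω, dist (codeApprox Φ x₀ k ω) (codeApprox Φ x₀ (k + 1) ω) ≤ C * r ^ k := by
    intro k
    induction k with
    | zero => intro ω; simpa [codeApprox, Real.dist_eq] using hC (ω 0)
    | succ k ih =>
      intro ω
      calc _ ≤ r * |codeApprox Φ x₀ k (fun j => ω (j + 1)) -
              codeApprox Φ x₀ (k + 1) (fun j => ω (j + 1))| := hΦ _ _ _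
        _ ≤ r * (C * r ^ k) := mul_le_mul_of_nonneg_left (ih _) hr0
        _ = C * r ^ (k + 1) := by ring
  choose π hπ using fun ω =>
    cauchySeq_tendsto_of_complete (cauchySeq_of_le_geometric r C hr1 fun k => hstep k ω)
  refine ⟨π, ?_, fun ω => ?_, fun ω => ?_⟩
  · have hunif : TendstoUniformly (codeApprox Φ x₀) π atTop := by
      rw [Metric.tendstoUniformly_iff]
      intro ε hε
      have hlim : Tendsto (fun k => C * r ^ k / (1 - r)) atTop (𝓝 0) := by
        simpa using ((tendsto_pow_atTop_nhds_zero_of_lt_one hr0 hr1).const_mul C).div_const (1 - r)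
      filter_upwards [hlim.eventually (gt_mem_nhds hε)] with k hk ω
      rw [dist_comm]
      exact (dist_le_of_le_geometric_of_tendsto r C hr1 (fun k => hstep k ω) (hπ ω) k).trans_lt hk
    exact hunif.continuous (Frequently.of_forall hapc)
  · exact hK.mem_of_tendsto (hπ ω) (Eventually.of_forall fun k => hmem k ω)
  · refine tendsto_nhds_unique ((tendsto_add_atTop_iff_nat 1).2 (hπ ω)) ?_
    exact ((hcont _).tendsto _).comp (hπ _)

/-- Contracting maps preserving a closed set have an attractor in it. -/
lemma exists_isAttractor [NeZero n] (Φ : Fin n → ℝ → ℝ) {r : ℝ} (hr0 : 0 ≤ r) (hr1 : r < 1)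
    (hΦ : ∀ i x y, |Φ i x - Φ i y| ≤ r * |x - y|) {K : Set ℝ} (hK : IsClosed K)
    (hKne : K.Nonempty) (hmaps : ∀ i, Set.MapsTo (Φ i) K K) :
    ∃ E, IsAttractor Φ E ∧ E ⊆ K := by
  obtain ⟨π, hπc, hπK, hπ⟩ := exists_codingMap Φ hr0 hr1 hΦ hK hKne hmaps
  refine ⟨Set.range π, ⟨Set.range_nonempty π, isCompact_range hπc, ?_⟩, ?_⟩
  · apply Set.Subset.antisymm
    · rintro _ ⟨_, ⟨i, rfl⟩, _, ⟨ω, rfl⟩, rfl⟩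
      exact ⟨fun k => Nat.casesOn k i ω, hπ _⟩
    · rintro _ ⟨ω, rfl⟩
      exact Set.mem_iUnion.2 ⟨ω 0, _, ⟨_, rfl⟩, (hπ ω).symm⟩
  · rintro _ ⟨ω, rfl⟩
    exact hπK ω

/-- Bernoulli measures: the mass of the sequences that start with the word `w`. -/
lemma exists_bernoulliMeasure (m : Fin n → ℝ) (hm : ∀ i, 0 ≤ m i) (hsum : ∑ i, m i = 1) :
    ∃ P : Measure (ℕ → Fin n), IsProbabilityMeasure P ∧ ∀ w : List (Fin n),
      P {ω | ∀ k < w.length, w[k]? = some (ω k)} = ENNReal.ofReal (wordProd m w) := by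
  have h1 : ∑ i, ENNReal.ofReal (m i) = 1 := by
    rw [← ENNReal.ofReal_sum_of_nonneg fun i _ => hm i, hsum, ENNReal.ofReal_one]
  let ν : Measure (Fin n) := (PMF.ofFintype _ h1).toMeasure
  have hν : ∀ i, ν {i} = ENNReal.ofReal (m i) := fun i => by
    rw [PMF.toMeasure_apply_singleton _ _ (measurableSet_singleton i), PMF.ofFintype_apply]
  refine ⟨Measure.infinitePi fun _ => ν, inferInstance, fun w => ?_⟩
  have hset : {ω : ℕ → Fin n | ∀ k < w.length, w[k]? = some (ω k)} =
      Set.pi (Finset.range w.length : Finset ℕ) fun k => {i | w[k]? = some i} := by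
    ext ω
    simp [Set.mem_pi]
  rw [hset, Measure.infinitePi_pi _ fun k _ => Set.Finite.measurableSet (Set.toFinite _)]
  clear hset
  induction w with
  | nil => simp
  | cons i w ih =>
    rw [List.length_cons, Finset.prod_range_succ', wordProd_cons,
      ENNReal.ofReal_mul (hm i), ← ih, mul_comm]
    congr 1
    simp only [List.getElem?_cons_zero, Option.some.injEq]
    rw [← hν i]
    congr 1
    ext j
    simp [eq_comm]

/-- A map of the line that scales distances by `c` scales the Hausdorff measure by `c ^ s`. -/
lemma hausdorffMeasure_real_image_of_scaling {f : ℝ → ℝ} {c s : ℝ} (hc : 0 < c) (hs : 0 ≤ s)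
    (hf : ∀ x y, |f x - f y| = c * |x - y|) (A : Set ℝ) :
    (μH[s]).real (f '' A) = c ^ s * (μH[s] : Measure ℝ).real A := by
  have hL : LipschitzWith c.toNNReal f := LipschitzWith.of_dist_le_mul fun x y => by
    rw [Real.dist_eq, Real.dist_eq, Real.coe_toNNReal _ hc.le, hf]
  have hA : AntilipschitzWith c.toNNReal⁻¹ f := AntilipschitzWith.of_le_mul_dist fun x y => by
    rw [Real.dist_eq, Real.dist_eq, NNReal.coe_inv, Real.coe_toNNReal _ hc.le, hf]
    field_simp
    rfl
  have hne : c.toNNReal ≠ 0 := by simpa using hc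
  have h1 := hL.hausdorffMeasure_image_le hs A
  have h2 := hA.le_hausdorffMeasure_image hs A
  have heq : μH[s] (f '' A) = (c.toNNReal : ENNReal) ^ s * μH[s] A := by
    refine le_antisymm h1 ?_
    calc (c.toNNReal : ENNReal) ^ s * μH[s] A
        ≤ (c.toNNReal : ENNReal) ^ s * (((c.toNNReal⁻¹ : ℝ≥0) : ENNReal) ^ s * μH[s] (f '' A)) := by
          gcongr
      _ = μH[s] (f '' A) := by
          rw [← mul_assoc, ← ENNReal.mul_rpow_of_nonneg _ _ hs, ← ENNReal.coe_mul,
            mul_inv_cancel₀ hne, ENNReal.coe_one, ENNReal.one_rpow, one_mul]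
  rw [measureReal_def, heq, ENNReal.toReal_mul, ← ENNReal.toReal_rpow, measureReal_def]
  simp [hc.le]

namespace IsDustSystem

variable {ρ : Fin n → ℝ} {Φ : Fin n → ℝ → ℝ} {D : Set ℝ}

/-- Mass distribution principle for the Bernoulli measure with weights `ρ i ^ s`: a set whose trace
on `D` has smallest cylinder `w` has mass at most `ρ_w ^ s` and diameter at least `ρ_w * δ`. -/
lemma hausdorffMeasure_ne_zero (h : IsDustSystem ρ Φ D) {s : ℝ} (hs : 0 < s)
    (hsum : ∑ i, ρ i ^ s = 1) : μH[s] D ≠ 0 := by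
  have hm : ∀ i, 0 < ρ i ^ s := fun i => Real.rpow_pos_of_pos (h.pos i) s
  obtain ⟨P, hP, hPw⟩ := exists_bernoulliMeasure (fun i => ρ i ^ s) (fun i => (hm i).le) hsum
  obtain ⟨r, hr0, hr1, hr⟩ := h.exists_ratio_bound
  obtain ⟨δ, hδ0, hδ⟩ := h.exists_separation
  obtain ⟨π, hπc, hπD, hπ⟩ := exists_codingMap Φ hr0.le hr1
    (fun i x y => by rw [h.sim i x y]; exact mul_le_mul_of_nonneg_right (hr i) (abs_nonneg _))
    h.attr.isCompact.isClosed h.attr.nonempty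
    (fun i => Set.mapsTo_iff_image_subset.2 (h.image_subset i))
  have hcode : ∀ k ω, π ω ∈ wordCylinder Φ D (List.ofFn fun j : Fin k => ω j) := by
    intro k
    induction k with
    | zero => intro ω; simpa [cylinder_nil] using hπD ω
    | succ k ih =>
      intro ω
      rw [List.ofFn_succ, hπ ω]
      change _ ∈ wordCylinder Φ D ([ω 0] ++ List.ofFn fun j : Fin k => ω (j + 1))
      rw [cylinder_append]
      exact ⟨_, ih (fun j => ω (j + 1)), rfl⟩
  have hcyl : ∀ (V : Set ℝ) (w : List (Fin n)), V ∩ D ⊆ wordCylinder Φ D w →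
      P (π ⁻¹' V) ≤ ENNReal.ofReal (wordProd ρ w ^ s) := by
    intro V w hV
    rw [← wordProd_rpow h.pos, ← hPw w]
    refine measure_mono fun ω hω k hk => ?_
    have h1 := hV ⟨hω, hπD ω⟩
    have h2 := hcode w.length ω
    have h3 : w = List.ofFn fun j : Fin w.length => ω j := by
      by_contra hne
      exact Set.disjoint_left.1 (h.disjoint_cylinder (by simp) hne) h1 h2
    rw [h3]
    simp [hk]
  have hmass : ENNReal.ofReal (δ ^ s) • P.map π ≤ μH[s] := by
    refine Measure.le_hausdorffMeasure s _ 1 one_pos fun U _ => ?_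
    -- `U` is arbitrary; passing to its closure gives measurability without changing the diameter.
    rw [Measure.smul_apply, smul_eq_mul, ← Metric.ediam_closure U]
    have hle : P.map π U ≤ P (π ⁻¹' closure U) := by
      rw [← Measure.map_apply hπc.measurable isClosed_closure.measurableSet]
      exact measure_mono subset_closure
    refine (mul_le_mul_right hle _).trans ?_
    by_cases hnt : (closure U ∩ D).Nontrivial
    · obtain ⟨w, hw, x, hx, y, hy, hxy⟩ :=
        h.exists_minimal_cylinder hδ Set.inter_subset_right hnt
      have hw0 := wordProd_pos h.pos w
      calc ENNReal.ofReal (δ ^ s) * P (π ⁻¹' closure U)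
          ≤ ENNReal.ofReal (δ ^ s) * ENNReal.ofReal (wordProd ρ w ^ s) := by
            gcongr
            exact hcyl _ w hw
        _ = ENNReal.ofReal (wordProd ρ w * δ) ^ s := by
            rw [← ENNReal.ofReal_mul (by positivity), ← Real.mul_rpow hδ0.le hw0.le,
              ENNReal.ofReal_rpow_of_pos (by positivity), mul_comm δ]
        _ ≤ Metric.ediam (closure U) ^ s := by
            refine ENNReal.rpow_le_rpow ?_ hs.le
            refine le_trans ?_ (Metric.edist_le_ediam_of_mem hx.1 hy.1)
            rw [edist_dist, Real.dist_eq]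
            exact ENNReal.ofReal_le_ofReal hxy
    · have hsub := Set.not_nontrivial_iff.1 hnt
      suffices hz : P (π ⁻¹' closure U) = 0 by rw [hz, mul_zero]; exact zero_le
      rcases hsub.eq_empty_or_singleton with he | ⟨x, hx⟩
      · rw [show π ⁻¹' closure U = ∅ from Set.eq_empty_of_forall_notMem fun ω hω => by
          have : π ω ∈ closure U ∩ D := ⟨hω, hπD ω⟩
          rw [he] at this
          exact this, measure_empty]
      · have hxD : x ∈ D := by
          have : x ∈ closure U ∩ D := by rw [hx]; rfl
          exact this.2
        -- A single point has no mass, since it lies in cylinders of every depth.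
        have hbound : ∀ k : ℕ, P (π ⁻¹' closure U) ≤ ENNReal.ofReal ((r ^ k) ^ s) := by
          intro k
          obtain ⟨w, hwl, hw⟩ := h.exists_cylinder hxD k
          refine (hcyl _ w (by rw [hx]; simpa using hw)).trans (ENNReal.ofReal_le_ofReal ?_)
          rw [← hwl]
          exact Real.rpow_le_rpow (wordProd_pos h.pos w).le (wordProd_le_pow h.pos hr w) hs.le
        have hlim : Tendsto (fun k : ℕ => ENNReal.ofReal ((r ^ k) ^ s)) atTop (𝓝 0) := by
          have h1 : Tendsto (fun k : ℕ => (r ^ k) ^ s) atTop (𝓝 (0 ^ s)) :=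
            ((Real.continuousAt_rpow_const 0 s (Or.inr hs.le)).tendsto).comp
              (tendsto_pow_atTop_nhds_zero_of_lt_one hr0.le hr1)
          rw [Real.zero_rpow hs.ne'] at h1
          simpa using ENNReal.tendsto_ofReal h1
        exact nonpos_iff_eq_zero.1 (ge_of_tendsto' hlim hbound)
  intro h0
  have h1 := hmass D
  rw [h0, Measure.smul_apply, smul_eq_mul,
    Measure.map_apply hπc.measurable h.attr.isCompact.measurableSet,
    show π ⁻¹' D = Set.univ from Set.eq_univ_of_forall hπD, measure_univ, mul_one] at h1
  have h2 : 0 < δ ^ s := by positivity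
  simp only [nonpos_iff_eq_zero, ENNReal.ofReal_eq_zero] at h1
  linarith

/-- Cover `D` by the cylinders of level `k`: the sum of `diam ^ s` is at most `(∑ ρ_i ^ s) ^ k * d ^
s = d ^ s`. -/
lemma hausdorffMeasure_ne_top (h : IsDustSystem ρ Φ D) {s : ℝ} (hs : 0 < s)
    (hsum : ∑ i, ρ i ^ s = 1) : μH[s] D ≠ ⊤ := by
  obtain ⟨r, hr0, hr1, hr⟩ := h.exists_ratio_bound
  obtain ⟨d, hd0, hd⟩ := h.exists_diam_bound
  have hdiam : ∀ w, Metric.ediam (wordCylinder Φ D w) ≤ ENNReal.ofReal (wordProd ρ w * d) := by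
    intro w
    refine Metric.ediam_le fun x hx y hy => ?_
    rw [edist_dist, Real.dist_eq]
    exact ENNReal.ofReal_le_ofReal (hd w x hx y hy)
  have hlim : Tendsto (fun k : ℕ => ENNReal.ofReal (r ^ k * d)) atTop (𝓝 0) := by
    have := (tendsto_pow_atTop_nhds_zero_of_lt_one hr0.le hr1).mul_const d
    simpa using ENNReal.tendsto_ofReal this
  have hle := Measure.hausdorffMeasure_le_liminf_sum (ι := fun k : ℕ => Fin k → Fin n) s D
    (l := atTop) _ hlim (fun k w => wordCylinder Φ D (List.ofFn w))
    (Eventually.of_forall fun k w => (hdiam _).trans (ENNReal.ofReal_le_ofReal (by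
      have := wordProd_le_pow h.pos hr (List.ofFn w)
      rw [List.length_ofFn] at this
      exact mul_le_mul_of_nonneg_right this hd0.le)))
    (Eventually.of_forall fun k x hx => by
      obtain ⟨w, hwl, hw⟩ := h.exists_cylinder hx k
      subst hwl
      exact Set.mem_iUnion.2 ⟨fun j => w[j], by simpa using hw⟩)
  refine ne_top_of_le_ne_top (b := ENNReal.ofReal (d ^ s)) ENNReal.ofReal_ne_top (hle.trans ?_)
  refine (liminf_le_liminf (Eventually.of_forall fun k => ?_)).trans
    (liminf_const (f := (atTop : Filter ℕ)) (ENNReal.ofReal (d ^ s))).le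
  calc ∑ w : Fin k → Fin n, Metric.ediam (wordCylinder Φ D (List.ofFn w)) ^ s
      ≤ ∑ w : Fin k → Fin n, ENNReal.ofReal ((∏ j, ρ (w j) ^ s) * d ^ s) := by
        refine Finset.sum_le_sum fun w _ => ?_
        refine (ENNReal.rpow_le_rpow (hdiam _) hs.le).trans ?_
        have hw0 := wordProd_pos h.pos (List.ofFn w)
        rw [ENNReal.ofReal_rpow_of_pos (by positivity), Real.mul_rpow hw0.le hd0.le,
          ← wordProd_rpow h.pos]
        simp [wordProd, List.map_ofFn, List.prod_ofFn]
    _ = ENNReal.ofReal (d ^ s) := by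
        rw [← ENNReal.ofReal_sum_of_nonneg, ← Finset.sum_mul, ← Fintype.sum_pow (fun i => ρ i ^ s), hsum, one_pow,
          one_mul]
        intro w _
        exact mul_nonneg (Finset.prod_nonneg fun j _ => (Real.rpow_pos_of_pos (h.pos _) s).le)
          (by positivity)

end IsDustSystem

end Coding

/-! ### Constancy of ratios in trees with finitely many relative ratios -/

section Ratio

/-- The factors in `F` that exceed 1 do so by at least some `ε`. Below a node whose ratio `a / b` is
within the factor `1 + ε` of the supremum, the ratio can therefore never increase. As `a` and `b`
are both additive, it cannot decrease at any child either. -/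
lemma exists_ratio_constant {P : Type*} (kids : P → List P) (a b : P → ℝ) (Q : P → Prop)
    (hroot : ∃ p, Q p) (hkids : ∀ p, Q p → ∀ k ∈ kids p, Q k) (ha : ∀ p, Q p → 0 < a p)
    (hb : ∀ p, Q p → 0 < b p) (hasum : ∀ p, Q p → a p = ((kids p).map a).sum)
    (hbsum : ∀ p, Q p → b p = ((kids p).map b).sum) {M : ℝ} (hM : ∀ p, Q p → a p ≤ M * b p)
    {F : Set ℝ} (hF : F.Finite)
    (hratio : ∀ p, Q p → ∀ k ∈ kids p, a k / b k / (a p / b p) ∈ F) :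
    ∃ p, Q p ∧ ∀ q, Relation.ReflTransGen (fun p k => k ∈ kids p) p q →
      Q q ∧ a q = a p / b p * b q := by
  obtain ⟨ε, hε, hεF⟩ : ∃ ε > 0, ∀ x ∈ F, 1 < x → 1 + ε ≤ x := by
    have hF' : (F ∩ Set.Ioi 1).Finite := hF.inter_of_left _
    rcases (F ∩ Set.Ioi 1).eq_empty_or_nonempty with he | hne
    · refine ⟨1, one_pos, fun x hx hx1 => ?_⟩
      have : x ∈ F ∩ Set.Ioi 1 := ⟨hx, hx1⟩
      rw [he] at this
      exact this.elim
    · obtain ⟨y, hy, hmin⟩ := hF'.exists_minimal hne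
      refine ⟨y - 1, sub_pos.2 hy.2, fun x hx hx1 => ?_⟩
      rcases le_total y x with h | h
      · linarith
      · linarith [hmin ⟨hx, hx1⟩ h]
  set R : Set ℝ := {x | ∃ p, Q p ∧ x = a p / b p}
  have hRb : BddAbove R := by
    refine ⟨M, ?_⟩
    rintro _ ⟨p, hp, rfl⟩
    exact (div_le_iff₀ (hb p hp)).2 (hM p hp)
  obtain ⟨p₀, hp₀⟩ := hroot
  have hRpos : 0 < sSup R :=
    (div_pos (ha p₀ hp₀) (hb p₀ hp₀)).trans_le (le_csSup hRb ⟨p₀, hp₀, rfl⟩)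
  obtain ⟨_, ⟨p, hp, rfl⟩, hlt⟩ := exists_lt_of_lt_csSup (s := R) ⟨_, p₀, hp₀, rfl⟩
    (show sSup R / (1 + ε) < sSup R from div_lt_self hRpos (by linarith))
  rw [div_lt_iff₀ (by positivity)] at hlt
  refine ⟨p, hp, fun q hq => ?_⟩
  induction hq with
  | refl => exact ⟨hp, by rw [div_mul_cancel₀ _ (hb p hp).ne']⟩
  | @tail q k _ hk ih =>
    obtain ⟨hQ, hqr⟩ := ih
    have hr0 : 0 < a p / b p := div_pos (ha p hp) (hb p hp)
    have hle : ∀ c ∈ kids q, a c ≤ a p / b p * b c := by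
      intro c hc
      have hQc := hkids q hQ c hc
      have hmem := hratio q hQ c hc
      have hqe : a q / b q = a p / b p := by
        rw [hqr, mul_div_cancel_right₀ _ (hb q hQ).ne']
      rw [hqe] at hmem
      have hcle : a c / b c ≤ a p / b p := by
        by_contra hgt
        push Not at hgt
        have h1 := hεF _ hmem ((one_lt_div hr0).2 hgt)
        rw [le_div_iff₀ hr0] at h1
        have h2 : a c / b c ≤ sSup R := le_csSup hRb ⟨c, hQc, rfl⟩
        linarith
      exact (div_le_iff₀ (hb c hQc)).1 hcle
    refine ⟨hkids q hQ k hk, le_antisymm (hle k hk) ?_⟩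
    by_contra hgt
    push Not at hgt
    have h1 : ((kids q).map a).sum < ((kids q).map fun c => a p / b p * b c).sum :=
      List.sum_lt_sum _ _ hle ⟨k, hk, hgt⟩
    rw [List.sum_map_mul_left, ← hbsum q hQ, ← hasum q hQ] at h1
    linarith

end Ratio

/-! ### Polynomial identities between the weights -/

section Weights

open MvPolynomial

/-- The weights `μ₀ = μ₃ = (1 - μ₁ - μ₂) / 2`, `μ₁`, `μ₂` as polynomials in `μ₁`, `μ₂`. -/
noncomputable def weightPoly : Fin 4 → MvPolynomial (Fin 2) ℚ :=
  ![C (1 / 2) * (1 - X 0 - X 1), X 0, X 1, C (1 / 2) * (1 - X 0 - X 1)]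

lemma aeval_weightPoly {m : Fin 4 → ℝ} (h03 : m 0 = m 3) (hsum : ∑ i, m i = 1) (i : Fin 4) :
    aeval ![m 1, m 2] (weightPoly i) = m i := by
  rw [Fin.sum_univ_four] at hsum
  fin_cases i <;> simp [weightPoly] <;> linarith

lemma aeval_wordProd_weightPoly {m : Fin 4 → ℝ} (h03 : m 0 = m 3) (hsum : ∑ i, m i = 1)
    (w : List (Fin 4)) : aeval ![m 1, m 2] (wordProd weightPoly w) = wordProd m w := by
  have := map_wordProd (aeval ![m 1, m 2] : MvPolynomial (Fin 2) ℚ →ₐ[ℚ] ℝ).toRingHom weightPoly w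
  simpa [aeval_weightPoly h03 hsum] using this

variable {m : Fin 4 → ℝ}

/-- If the weights are algebraically independent, a word whose weight is a power of `μ₀` contains
only the letters `0` and `3`. -/
lemma letters_of_wordProd_eq_pow (h03 : m 0 = m 3) (hsum : ∑ i, m i = 1)
    (hind : ∀ P : MvPolynomial (Fin 2) ℚ, aeval ![m 1, m 2] P = 0 → P = 0)
    {w : List (Fin 4)} {k : ℕ} (hw : wordProd m w = m 0 ^ k) : ∀ i ∈ w, i = 0 ∨ i = 3 := by
  have h0 : wordProd weightPoly w - weightPoly 0 ^ k = 0 := by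
    apply hind
    rw [map_sub, map_pow, aeval_wordProd_weightPoly h03 hsum, aeval_weightPoly h03 hsum, hw,
      sub_self]
  -- At `μ₁ = μ₂ = 0` a word containing 1 or 2 has weight 0, whereas `μ₀ ^ k` becomes `(1 / 2) ^ k`.
  have h1 := congrArg (eval (![0, 0] : Fin 2 → ℚ)) h0
  rw [map_sub, map_pow, map_wordProd, map_zero] at h1
  intro i hi
  by_contra hne
  have hz : wordProd (fun i => eval (![0, 0] : Fin 2 → ℚ) (weightPoly i)) w = 0 := by
    refine List.prod_eq_zero (List.mem_map.2 ⟨i, hi, ?_⟩)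
    fin_cases i <;> simp_all [weightPoly]
  rw [hz] at h1
  simp [weightPoly] at h1

/-- If the weights are algebraically independent and `(∑_{u ∈ S} μ_u) μ₁ (1 - μ₀)` is divisible by
`μ₁ + μ₂` in the polynomial ring, then every word of `S` contains one of the letters `1`, `2`. -/
lemma exists_letter_of_dvd (h03 : m 0 = m 3) (hsum : ∑ i, m i = 1)
    (hind : ∀ P : MvPolynomial (Fin 2) ℚ, aeval ![m 1, m 2] P = 0 → P = 0)
    {ι : Type*} (word : ι → List (Fin 4)) (S S₁ S₂ : Finset ι)
    (hid : (∑ u ∈ S₁, wordProd m (word u) + ∑ u ∈ S₂, wordProd m (word u)) * (m 1 + m 2) =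
      (∑ u ∈ S, wordProd m (word u)) * (m 1 * (1 - m 0))) :
    ∀ u ∈ S, ¬ ∀ i ∈ word u, i = 0 ∨ i = 3 := by
  let q : Finset ι → MvPolynomial (Fin 2) ℚ := fun S => ∑ u ∈ S, wordProd weightPoly (word u)
  have hq : ∀ S, aeval ![m 1, m 2] (q S) = ∑ u ∈ S, wordProd m (word u) := fun S => by
    simp only [q, map_sum, aeval_wordProd_weightPoly h03 hsum]
  have h0 : (q S₁ + q S₂) * (weightPoly 1 + weightPoly 2) -
      q S * (weightPoly 1 * (1 - weightPoly 0)) = 0 := by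
    apply hind
    simp only [map_sub, map_mul, map_add, map_one, hq, aeval_weightPoly h03 hsum, hid, sub_self]
  -- On the line `μ₂ = -μ₁` the factor `μ₁ + μ₂` vanishes and `μ₀ = 1 / 2`, so `μ₁ (1 - μ₀)` becomes
  -- `X / 2`, which can be cancelled. Evaluating at the origin at once would lose everything to the
  -- factor `μ₁`.
  have h1 := congrArg (aeval (![Polynomial.X, -Polynomial.X] : Fin 2 → Polynomial ℚ)) h0
  have h2 : aeval (![Polynomial.X, -Polynomial.X] : Fin 2 → Polynomial ℚ) (q S) = 0 := by
    have hne : (Polynomial.X * (1 - Polynomial.C (1 / 2)) : Polynomial ℚ) ≠ 0 := by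
      rw [← Polynomial.C_1, ← Polynomial.C_sub]
      exact mul_ne_zero Polynomial.X_ne_zero (Polynomial.C_ne_zero.2 (by norm_num))
    have hw0 : aeval (![Polynomial.X, -Polynomial.X] : Fin 2 → Polynomial ℚ) (weightPoly 0) =
        Polynomial.C (1 / 2) := by simp [weightPoly]
    have hw1 : aeval (![Polynomial.X, -Polynomial.X] : Fin 2 → Polynomial ℚ) (weightPoly 1) =
        Polynomial.X := by simp [weightPoly]
    have hw2 : aeval (![Polynomial.X, -Polynomial.X] : Fin 2 → Polynomial ℚ) (weightPoly 2) =
        -Polynomial.X := by simp [weightPoly]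
    rw [map_sub, map_mul, map_mul, map_mul, map_add, map_sub, map_one, map_zero, map_add, hw0, hw1,
      hw2, add_neg_cancel, mul_zero, zero_sub, neg_eq_zero] at h1
    exact (mul_eq_zero.1 h1).resolve_right hne
  -- At the origin the weights are `1/2, 0, 0, 1/2`; a vanishing sum of nonnegative terms has all
  -- terms zero.
  have h3 := congrArg (Polynomial.eval 0) h2
  have h4 : ∀ i, Polynomial.eval 0 (aeval (![Polynomial.X, -Polynomial.X] :
      Fin 2 → Polynomial ℚ) (weightPoly i)) = (![1 / 2, 0, 0, 1 / 2] : Fin 4 → ℚ) i := by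
    intro i
    fin_cases i <;> simp [weightPoly]
  have h5 : ∀ w, Polynomial.eval 0 (aeval (![Polynomial.X, -Polynomial.X] :
      Fin 2 → Polynomial ℚ) (wordProd weightPoly w)) =
      wordProd (![1 / 2, 0, 0, 1 / 2] : Fin 4 → ℚ) w := by
    intro w
    have := map_wordProd ((Polynomial.evalRingHom 0).comp (aeval (![Polynomial.X, -Polynomial.X] :
      Fin 2 → Polynomial ℚ)).toRingHom) weightPoly w
    simpa [h4] using this
  simp only [q, map_sum, Polynomial.eval_finsetSum, h5, Polynomial.eval_zero] at h3
  have hnn : ∀ i, 0 ≤ (![1 / 2, 0, 0, 1 / 2] : Fin 4 → ℚ) i := by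
    intro i
    fin_cases i <;> norm_num
  rw [Finset.sum_eq_zero_iff_of_nonneg fun u _ => List.prod_nonneg fun x hx => by
    obtain ⟨i, -, rfl⟩ := List.mem_map.1 hx
    exact hnn i] at h3
  intro u hu hlet
  have h6 := h3 u hu
  rw [wordProd, List.prod_eq_zero_iff, List.mem_map] at h6
  obtain ⟨i, hi, hi0⟩ := h6
  rcases hlet i hi with rfl | rfl <;> simp at hi0

end Weights

/-! ### Strongly separated graph-directed structure of the touching attractor -/

section GraphDirected

open MeasureTheory

/-- The image of `Y τ` under `x ↦ r x + c`, for `p = (τ, r, c)`. -/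
def pieceSet (Y : Bool → Set ℝ) (p : Bool × ℝ × ℝ) : Set ℝ :=
  (fun x => p.2.1 * x + p.2.2) '' Y p.1

/-- The pieces into which a piece is decomposed. -/
def pieceKids (E : Bool → List (Bool × ℝ × ℝ)) (p : Bool × ℝ × ℝ) : List (Bool × ℝ × ℝ) :=
  (E p.1).map fun e => (e.1, p.2.1 * e.2.1, p.2.1 * e.2.2 + p.2.2)

/-- Two compact subsets of `[0,1]` that decompose into scaled copies of each other according to
`E`, the copies being at distance at least `κ`. -/
structure IsGraphDirected (E : Bool → List (Bool × ℝ × ℝ)) (Y : Bool → Set ℝ) (κ : ℝ) : Prop where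
  isCompact : ∀ τ, IsCompact (Y τ)
  subset_Icc : ∀ τ, Y τ ⊆ Set.Icc 0 1
  ratio_pos : ∀ τ, ∀ e ∈ E τ, 0 < e.2.1
  ratio_le_one : ∀ τ, ∀ e ∈ E τ, e.2.1 ≤ 1
  gap_pos : 0 < κ
  mem_iff : ∀ τ x, x ∈ Y τ ↔ ∃ e ∈ E τ, x ∈ pieceSet Y e
  separated : ∀ τ, (E τ).Pairwise fun e e' =>
    ∀ x ∈ pieceSet Y e, ∀ y ∈ pieceSet Y e', κ ≤ |x - y|

/-- A piece that is contained in `T = Y false` and isolated in it at its own scale. -/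
structure IsIsolatedPiece (Y : Bool → Set ℝ) (κ : ℝ) (p : Bool × ℝ × ℝ) : Prop where
  ratio_pos : 0 < p.2.1
  subset : pieceSet Y p ⊆ Y false
  isolated : ∀ x ∈ pieceSet Y p, ∀ y ∈ Y false \ pieceSet Y p, κ * p.2.1 ≤ |x - y|

lemma measureReal_biUnion_list {α : Type*} (μ : Measure ℝ) (l : List α) (f : α → Set ℝ)
    (hm : ∀ a ∈ l, MeasurableSet (f a)) (hfin : ∀ a ∈ l, μ (f a) ≠ ⊤)
    (hd : l.Pairwise fun a b => Disjoint (f a) (f b)) :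
    μ.real (⋃ a ∈ l, f a) = (l.map fun a => μ.real (f a)).sum := by
  induction l with
  | nil => simp
  | cons a l ih =>
    rw [List.pairwise_cons] at hd
    have hset : ⋃ b ∈ a :: l, f b = f a ∪ ⋃ b ∈ l, f b := by
      ext x; simp
    have hml : MeasurableSet (⋃ b ∈ l, f b) :=
      (List.finite_toSet l).measurableSet_biUnion
        fun b hb => hm b (List.mem_cons_of_mem _ hb)
    have hfl : μ (⋃ b ∈ l, f b) ≠ ⊤ :=
      (measure_biUnion_lt_top (List.finite_toSet l)
        fun b hb => (hfin b (List.mem_cons_of_mem _ hb)).lt_top).ne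
    rw [hset, measureReal_union (Set.disjoint_iUnion₂_right.2 hd.1) hml
      (hfin a List.mem_cons_self) hfl, List.map_cons, List.sum_cons,
      ih (fun b hb => hm b (List.mem_cons_of_mem _ hb))
        (fun b hb => hfin b (List.mem_cons_of_mem _ hb)) hd.2]

namespace IsGraphDirected

variable {E : Bool → List (Bool × ℝ × ℝ)} {Y : Bool → Set ℝ} {κ : ℝ}

lemma isCompact_pieceSet (h : IsGraphDirected E Y κ) (p : Bool × ℝ × ℝ) :
    IsCompact (pieceSet Y p) :=
  (h.isCompact _).image (by fun_prop)

lemma pieceSet_kid (Y : Bool → Set ℝ) (p e : Bool × ℝ × ℝ) :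
    pieceSet Y (e.1, p.2.1 * e.2.1, p.2.1 * e.2.2 + p.2.2) =
      (fun x => p.2.1 * x + p.2.2) '' pieceSet Y e := by
  rw [pieceSet, pieceSet, Set.image_image]
  congr 1
  funext x
  ring

lemma pieceSet_eq_biUnion (h : IsGraphDirected E Y κ) (p : Bool × ℝ × ℝ) :
    pieceSet Y p = ⋃ k ∈ pieceKids E p, pieceSet Y k := by
  have h1 : Y p.1 = ⋃ e ∈ E p.1, pieceSet Y e := by
    ext x
    simp [h.mem_iff p.1 x]
  ext x
  simp only [pieceKids, List.mem_map, Set.mem_iUnion]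
  constructor
  · rintro ⟨y, hy, rfl⟩
    rw [h1] at hy
    simp only [Set.mem_iUnion] at hy
    obtain ⟨e, he, hye⟩ := hy
    exact ⟨_, ⟨e, he, rfl⟩, by rw [pieceSet_kid]; exact Set.mem_image_of_mem _ hye⟩
  · rintro ⟨_, ⟨e, he, rfl⟩, hx⟩
    rw [pieceSet_kid] at hx
    obtain ⟨y, hy, rfl⟩ := hx
    exact ⟨y, (h.mem_iff _ _).2 ⟨e, he, hy⟩, rfl⟩

lemma pieceSet_kid_subset (h : IsGraphDirected E Y κ) {p k : Bool × ℝ × ℝ}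
    (hk : k ∈ pieceKids E p) : pieceSet Y k ⊆ pieceSet Y p := by
  rw [h.pieceSet_eq_biUnion p]
  exact Set.subset_biUnion_of_mem (u := fun k => pieceSet Y k) hk

lemma separated_kids (h : IsGraphDirected E Y κ) {p : Bool × ℝ × ℝ} (hp : 0 < p.2.1) :
    (pieceKids E p).Pairwise fun k k' =>
      ∀ x ∈ pieceSet Y k, ∀ y ∈ pieceSet Y k', κ * p.2.1 ≤ |x - y| := by
  rw [pieceKids, List.pairwise_map]
  refine (h.separated p.1).imp fun {e e'} hee x hx y hy => ?_
  rw [pieceSet_kid] at hx hy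
  obtain ⟨x', hx', rfl⟩ := hx
  obtain ⟨y', hy', rfl⟩ := hy
  have h1 := hee x' hx' y' hy'
  rw [add_sub_add_right_eq_sub, ← mul_sub, abs_mul, abs_of_pos hp, mul_comm]
  exact mul_le_mul_of_nonneg_left h1 hp.le

lemma isIsolatedPiece_root : IsIsolatedPiece Y κ (false, 1, 0) where
  ratio_pos := one_pos
  subset := by simp [pieceSet]
  isolated := by
    rintro x - y ⟨hy, hy'⟩
    simp [pieceSet, hy] at hy'

/-- A point of `Y false` outside the part lies either in a sibling, at distance at least `κ` times
the ratio of `p`, or outside `p`. Ratios do not grow on passing to parts. -/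
lemma isIsolatedPiece_kid (h : IsGraphDirected E Y κ) {p k : Bool × ℝ × ℝ}
    (hp : IsIsolatedPiece Y κ p) (hk : k ∈ pieceKids E p) : IsIsolatedPiece Y κ k := by
  have hk' := hk
  rw [pieceKids, List.mem_map] at hk'
  obtain ⟨e, he, rfl⟩ := hk'
  have hle : p.2.1 * e.2.1 ≤ p.2.1 :=
    mul_le_of_le_one_right hp.ratio_pos.le (h.ratio_le_one _ e he)
  refine ⟨mul_pos hp.ratio_pos (h.ratio_pos _ e he),
    (h.pieceSet_kid_subset hk).trans hp.subset, fun x hx y hy => ?_⟩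
  refine (mul_le_mul_of_nonneg_left hle h.gap_pos.le).trans ?_
  by_cases hyp : y ∈ pieceSet Y p
  · rw [h.pieceSet_eq_biUnion p] at hyp
    simp only [Set.mem_iUnion] at hyp
    obtain ⟨k', hk', hyk'⟩ := hyp
    have : Std.Symm fun k k' : Bool × ℝ × ℝ =>
        ∀ x ∈ pieceSet Y k, ∀ y ∈ pieceSet Y k', κ * p.2.1 ≤ |x - y| := ⟨by
      intro k k' hkk x hx y hy
      rw [abs_sub_comm]
      exact hkk y hy x hx⟩
    refine (h.separated_kids hp.ratio_pos).forall hk hk' ?_ x hx y hyk'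
    rintro rfl
    exact hy.2 hyk'
  · exact hp.isolated x (h.pieceSet_kid_subset hk hx) y ⟨hy.1, hyp⟩

/-- Additivity of a measure over the images of the parts of a piece. -/
lemma measureReal_image_pieceSet (h : IsGraphDirected E Y κ) (μ : Measure ℝ) {g : ℝ → ℝ}
    (hg : ContinuousOn g (Y false)) (hinj : Set.InjOn g (Y false))
    (hfin : μ (g '' Y false) ≠ ⊤) {p : Bool × ℝ × ℝ} (hp : IsIsolatedPiece Y κ p) :
    μ.real (g '' pieceSet Y p) =
      ((pieceKids E p).map fun k => μ.real (g '' pieceSet Y k)).sum := by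
  have hsub : ∀ k ∈ pieceKids E p, pieceSet Y k ⊆ Y false := fun k hk =>
    (h.pieceSet_kid_subset hk).trans hp.subset
  rw [← measureReal_biUnion_list μ (pieceKids E p) (fun k => g '' pieceSet Y k),
    h.pieceSet_eq_biUnion p, Set.image_iUnion₂]
  · exact fun k hk => ((h.isCompact_pieceSet k).image_of_continuousOn
      (hg.mono (hsub k hk))).measurableSet
  · exact fun k hk => ne_top_of_le_ne_top hfin (measure_mono (Set.image_mono (hsub k hk)))
  · refine (h.separated_kids hp.ratio_pos).imp_of_mem fun {k k'} hk hk' hkk => ?_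
    rw [Set.disjoint_left]
    rintro _ ⟨x, hx, rfl⟩ ⟨y, hy, hxy⟩
    have := hkk x hx y hy
    rw [hinj (hsub k' hk' hy) (hsub k hk hx) hxy, sub_self, abs_zero] at this
    exact absurd this (not_le.2 (mul_pos h.gap_pos hp.ratio_pos))

end IsGraphDirected

/-- The decomposition of the touching attractor (`false`) and of the union of its two touching
parts (`true`). -/
def touchEdges (ρ t : Fin 4 → ℝ) : Bool → List (Bool × ℝ × ℝ)
  | false => [(false, ρ 0, 0), (true, 1, 0), (false, ρ 0, t 3)]
  | true => [(false, ρ 1 * ρ 0, t 1), (true, ρ 1, t 1), (true, ρ 0, t 2 * (1 - ρ 0)),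
      (true, ρ 2, t 2), (false, ρ 2 * ρ 0, ρ 2 * t 3 + t 2)]

/-- The touching attractor and the union of its two touching parts. -/
def touchSets (ρ t : Fin 4 → ℝ) (T : Set ℝ) : Bool → Set ℝ
  | false => T
  | true => affineIFS ρ t 1 '' T ∪ affineIFS ρ t 2 '' T

/-- The least point satisfies `a = ρ_i y + t_i ≥ ρ_i a` with `ρ_i < 1`, so `a ≥ 0`; the greatest
point is treated alike. -/
lemma attractor_subset_Icc {n : ℕ} {ρ t : Fin n → ℝ} {T : Set ℝ} (hρ : IsContractionVector ρ)
    (h0 : ∀ i, 0 ≤ t i) (h1 : ∀ i, ρ i + t i ≤ 1) (hT : IsAttractor (affineIFS ρ t) T) :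
    T ⊆ Set.Icc 0 1 := by
  have hmem : ∀ x ∈ T, ∃ i, ∃ y ∈ T, ρ i * y + t i = x := by
    intro x hx
    rw [← hT.iUnion_image] at hx
    obtain ⟨i, y, hy, hxy⟩ := Set.mem_iUnion.1 hx
    exact ⟨i, y, hy, hxy⟩
  obtain ⟨a, ha, hmin⟩ := hT.isCompact.exists_isLeast hT.nonempty
  obtain ⟨b, hb, hmax⟩ := hT.isCompact.exists_isGreatest hT.nonempty
  have ha0 : 0 ≤ a := by
    obtain ⟨i, y, hy, hya⟩ := hmem a ha
    nlinarith [hmin hy, h0 i, hρ.pos i, hρ.lt_one i]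
  have hb1 : b ≤ 1 := by
    obtain ⟨i, y, hy, hyb⟩ := hmem b hb
    nlinarith [hmax hy, h1 i, hρ.pos i, hρ.lt_one i]
  exact fun x hx => ⟨ha0.trans (hmin hx), (hmax hx).trans hb1⟩

/-- The positions of the four intervals when exactly the two middle ones touch. -/
structure IsMiddleTouching (ρ t : Fin 4 → ℝ) : Prop where
  t_zero : t 0 = 0
  lt_one' : ρ 0 < t 1
  touch : ρ 1 + t 1 = t 2
  lt_three : ρ 2 + t 2 < t 3
  t_three : ρ 3 + t 3 = 1

lemma isMiddleTouching {ρ t : Fin 4 → ℝ} (h : IsTouchingIFS ρ t)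
    (hT₁ : touchingLetters ρ t = {1}) : IsMiddleTouching ρ t := by
  have h0 := h.left_end 0 rfl
  have h3 := h.right_end 3 rfl
  have h01 := h.ordered 0 1 (by decide)
  have h23 := h.ordered 2 3 (by decide)
  simp only [affineIFS, mul_one, mul_zero, zero_add] at h0 h3 h01 h23
  have hm1 : (1 : Fin 4) ∈ touchingLetters ρ t := by rw [hT₁]; rfl
  obtain ⟨j, hj, hj'⟩ := hm1
  have hj2 : j = 2 := Fin.ext hj
  subst hj2
  simp only [affineIFS, mul_one, mul_zero, zero_add] at hj'
  rw [h0, add_zero] at h01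
  refine ⟨h0, lt_of_le_of_ne h01 fun he => ?_, hj', lt_of_le_of_ne h23 fun he => ?_, h3⟩
  · have : (0 : Fin 4) ∈ touchingLetters ρ t := ⟨1, rfl, by simp [affineIFS, h0, he]⟩
    rw [hT₁] at this
    simp at this
  · have : (2 : Fin 4) ∈ touchingLetters ρ t := ⟨3, rfl, by simp [affineIFS, he]⟩
    rw [hT₁] at this
    simp at this

/-- Pieces whose convex hulls are listed from left to right with gaps at least `κ` are
`κ`-separated. -/
lemma pairwise_separated_of_isChain {Y : Bool → Set ℝ} {κ : ℝ} (hκ : 0 ≤ κ)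
    {lo hi : Bool → ℝ} (hY : ∀ τ, Y τ ⊆ Set.Icc (lo τ) (hi τ)) (hlh : ∀ τ, lo τ ≤ hi τ)
    {l : List (Bool × ℝ × ℝ)} (hpos : ∀ e ∈ l, 0 < e.2.1)
    (hl : l.IsChain fun e e' =>
      e.2.1 * hi e.1 + e.2.2 + κ ≤ e'.2.1 * lo e'.1 + e'.2.2) :
    l.Pairwise fun e e' => ∀ x ∈ pieceSet Y e, ∀ y ∈ pieceSet Y e', κ ≤ |x - y| := by
  -- Positivity of the ratios is built into the relation because transitivity needs it for the
  -- middle piece.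
  let R : Bool × ℝ × ℝ → Bool × ℝ × ℝ → Prop := fun e e' =>
    e.2.1 * hi e.1 + e.2.2 + κ ≤ e'.2.1 * lo e'.1 + e'.2.2 ∧ 0 < e.2.1 ∧ 0 < e'.2.1
  have : IsTrans _ R := ⟨fun e₁ e₂ e₃ h₁ h₂ => by
    refine ⟨?_, h₁.2.1, h₂.2.2⟩
    have := mul_le_mul_of_nonneg_left (hlh e₂.1) h₂.2.1.le
    linarith [h₁.1, h₂.1]⟩
  have hR : l.IsChain R :=
    hl.imp_of_mem_imp fun e e' he he' h => ⟨h, hpos e he, hpos e' he'⟩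
  refine (List.isChain_iff_pairwise.1 hR).imp fun {e e'} hee => ?_
  rintro _ ⟨x, hx, rfl⟩ _ ⟨y, hy, rfl⟩
  have h1 := mul_le_mul_of_nonneg_left (hY _ hx).2 hee.2.1.le
  have h2 := mul_le_mul_of_nonneg_left (hY _ hy).1 hee.2.2.le
  rw [abs_sub_comm]
  refine le_trans ?_ (le_abs_self _)
  simp only
  linarith [hee.1]

/-- The parts `Ψ₁Ψ₃(T)` and `Ψ₂Ψ₀(T)` meeting at `t 2` have ratios `ρ₁ρ₃` and `ρ₂ρ₀`. As `ρ₀ = ρ₃`,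
their union is the image of `Ψ₁(T) ∪ Ψ₂(T)` under the homothety of ratio `ρ₀` centred at `t 2`. -/
lemma exists_isGraphDirected {ρ t : Fin 4 → ℝ} {T : Set ℝ} (hρ : IsContractionVector ρ)
    (h03 : ρ 0 = ρ 3) (ht : IsMiddleTouching ρ t) (hT : IsAttractor (affineIFS ρ t) T) :
    ∃ κ, IsGraphDirected (touchEdges ρ t) (touchSets ρ t T) κ := by
  obtain ⟨ht0, ht1, ht2, ht3, ht4⟩ := ht
  have hp := hρ.pos
  have hl := hρ.lt_one
  have e3 : t 3 = 1 - ρ 0 := by linarith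
  have hTI : T ⊆ Set.Icc 0 1 := by
    refine attractor_subset_Icc hρ (fun i => ?_) (fun i => ?_) hT
    · fin_cases i <;> simp <;> linarith [hp 0, hp 1, hp 2, hp 3]
    · fin_cases i <;> simp <;> linarith [hp 0, hp 1, hp 2, hp 3]
  have hTeq : ∀ x, x ∈ T ↔ ∃ i, ∃ y ∈ T, ρ i * y + t i = x := by
    intro x
    rw [← hT.iUnion_image, Set.mem_iUnion, hT.iUnion_image]
    rfl
  have hcont : ∀ i, Continuous (affineIFS ρ t i) := fun i => by
    unfold affineIFS
    fun_prop
  let lo : Bool → ℝ := fun τ => bif τ then t 1 else 0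
  let hi : Bool → ℝ := fun τ => bif τ then ρ 2 + t 2 else 1
  have hXI : ∀ τ, touchSets ρ t T τ ⊆ Set.Icc (lo τ) (hi τ) := by
    rintro (_ | _)
    · exact hTI
    · rintro _ (⟨x, hx, rfl⟩ | ⟨x, hx, rfl⟩)
      · have := hTI hx
        constructor <;> simp only [lo, hi, affineIFS, cond_true] <;>
          nlinarith [hp 1, hp 2, this.1, this.2]
      · have := hTI hx
        constructor <;> simp only [lo, hi, affineIFS, cond_true] <;>
          nlinarith [hp 1, hp 2, this.1, this.2]
  -- The gaps are the two gaps of the first level and their multiples by `ρ 1` and `ρ 2`; `κ` is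
  -- below all of them.
  set κ := ρ 1 * ρ 2 * min (t 1 - ρ 0) (t 3 - (ρ 2 + t 2)) with hκ
  have hg : 0 < min (t 1 - ρ 0) (t 3 - (ρ 2 + t 2)) := lt_min (by linarith) (by linarith)
  have hκ0 : 0 < κ := mul_pos (mul_pos (hp 1) (hp 2)) hg
  have hκ1 : κ ≤ ρ 1 * min (t 1 - ρ 0) (t 3 - (ρ 2 + t 2)) := by
    rw [hκ]; nlinarith [mul_pos (hp 1) hg, hl 2]
  have hκ2 : κ ≤ ρ 2 * min (t 1 - ρ 0) (t 3 - (ρ 2 + t 2)) := by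
    rw [hκ]; nlinarith [mul_pos (hp 2) hg, hl 1]
  have hκ3 : κ ≤ min (t 1 - ρ 0) (t 3 - (ρ 2 + t 2)) := by nlinarith [hl 1]
  have hm1 := min_le_left (t 1 - ρ 0) (t 3 - (ρ 2 + t 2))
  have hm2 := min_le_right (t 1 - ρ 0) (t 3 - (ρ 2 + t 2))
  have a1 := mul_le_mul_of_nonneg_left hm1 (hp 1).le
  have a2 := mul_le_mul_of_nonneg_left hm2 (hp 1).le
  have a3 := mul_le_mul_of_nonneg_left hm1 (hp 2).le
  have a4 := mul_le_mul_of_nonneg_left hm2 (hp 2).le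
  have hpos : ∀ τ, ∀ e ∈ touchEdges ρ t τ, 0 < e.2.1 := by
    rintro (_ | _) e he
    · simp only [touchEdges, List.mem_cons, List.not_mem_nil, or_false] at he
      rcases he with rfl | rfl | rfl <;> simp [hp]
    · simp only [touchEdges, List.mem_cons, List.not_mem_nil, or_false] at he
      rcases he with rfl | rfl | rfl | rfl | rfl <;> simp [hp]
  refine ⟨κ, ⟨?_, ?_, hpos, ?_, hκ0, ?_, ?_⟩⟩
  · rintro (_ | _)
    · exact hT.isCompact
    · exact (hT.isCompact.image (hcont 1)).union (hT.isCompact.image (hcont 2))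
  · rintro (_ | _)
    · exact hTI
    · refine (hXI true).trans (Set.Icc_subset_Icc ?_ ?_) <;> simp only [lo, hi, cond_true] <;>
        linarith [hp 0, hp 3]
  · rintro (_ | _) e he
    · simp only [touchEdges, List.mem_cons, List.not_mem_nil, or_false] at he
      rcases he with rfl | rfl | rfl <;> simp [(hl _).le]
    · simp only [touchEdges, List.mem_cons, List.not_mem_nil, or_false] at he
      rcases he with rfl | rfl | rfl | rfl | rfl <;>
        simp [(hl _).le, mul_le_one₀, (hp _).le]
  · rintro (_ | _) x
    · rw [show touchSets ρ t T false = T from rfl, hTeq]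
      simp only [touchEdges, List.mem_cons, List.not_mem_nil, or_false, exists_eq_or_imp,
        exists_eq_left, pieceSet, touchSets, Set.mem_image, Set.mem_union, affineIFS]
      constructor
      · rintro ⟨i, y, hy, rfl⟩
        fin_cases i
        · exact Or.inl ⟨y, hy, by simp [ht0]⟩
        · exact Or.inr (Or.inl ⟨_, Or.inl ⟨y, hy, rfl⟩, by simp⟩)
        · exact Or.inr (Or.inl ⟨_, Or.inr ⟨y, hy, rfl⟩, by simp⟩)
        · exact Or.inr (Or.inr ⟨y, hy, by simp [h03]⟩)
      · rintro (⟨y, hy, rfl⟩ | ⟨_, ⟨y, hy, rfl⟩ | ⟨y, hy, rfl⟩, rfl⟩ | ⟨y, hy, rfl⟩)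
        · exact ⟨0, y, hy, by simp [ht0]⟩
        · exact ⟨1, y, hy, by simp⟩
        · exact ⟨2, y, hy, by simp⟩
        · exact ⟨3, y, hy, by simp [h03]⟩
    · simp only [touchEdges, List.mem_cons, List.not_mem_nil, or_false, exists_eq_or_imp,
        exists_eq_left, pieceSet, touchSets, Set.mem_image, Set.mem_union, affineIFS]
      constructor
      · rintro (⟨y, hy, rfl⟩ | ⟨y, hy, rfl⟩) <;> obtain ⟨i, z, hz, rfl⟩ := (hTeq y).1 hy
        · fin_cases i
          · exact Or.inl ⟨z, hz, by simp [ht0]; ring⟩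
          · exact Or.inr (Or.inl ⟨_, Or.inl ⟨z, hz, rfl⟩, rfl⟩)
          · exact Or.inr (Or.inl ⟨_, Or.inr ⟨z, hz, rfl⟩, rfl⟩)
          · refine Or.inr (Or.inr (Or.inl ⟨_, Or.inl ⟨z, hz, rfl⟩, ?_⟩))
            simp only [← ht2]
            simp [e3, ← h03]
            ring
        · fin_cases i
          · refine Or.inr (Or.inr (Or.inl ⟨_, Or.inr ⟨z, hz, rfl⟩, ?_⟩))
            simp [ht0]
            ring
          · exact Or.inr (Or.inr (Or.inr (Or.inl ⟨_, Or.inl ⟨z, hz, rfl⟩, rfl⟩)))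
          · exact Or.inr (Or.inr (Or.inr (Or.inl ⟨_, Or.inr ⟨z, hz, rfl⟩, rfl⟩)))
          · exact Or.inr (Or.inr (Or.inr (Or.inr ⟨z, hz, by simp [← h03]; ring⟩)))
      · have hmem : ∀ i, ∀ y ∈ T, ρ i * y + t i ∈ T := fun i y hy => (hTeq _).2 ⟨i, y, hy, rfl⟩
        rintro (⟨y, hy, rfl⟩ | ⟨_, ⟨y, hy, rfl⟩ | ⟨y, hy, rfl⟩, rfl⟩ |
          ⟨_, ⟨y, hy, rfl⟩ | ⟨y, hy, rfl⟩, rfl⟩ | ⟨_, ⟨y, hy, rfl⟩ | ⟨y, hy, rfl⟩, rfl⟩ |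
          ⟨y, hy, rfl⟩)
        · exact Or.inl ⟨_, hmem 0 y hy, by rw [ht0]; ring⟩
        · exact Or.inl ⟨_, hmem 1 y hy, rfl⟩
        · exact Or.inl ⟨_, hmem 2 y hy, rfl⟩
        · exact Or.inl ⟨_, hmem 3 y hy, by rw [← h03, e3, ← ht2]; ring⟩
        · exact Or.inr ⟨_, hmem 0 y hy, by rw [ht0]; ring⟩
        · exact Or.inr ⟨_, hmem 1 y hy, rfl⟩
        · exact Or.inr ⟨_, hmem 2 y hy, rfl⟩
        · exact Or.inr ⟨_, hmem 3 y hy, by rw [← h03]; ring⟩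
  · intro τ
    refine pairwise_separated_of_isChain hκ0.le hXI ?_ (hpos τ) ?_
    · rintro (_ | _) <;> simp only [lo, hi, cond_true, cond_false] <;> linarith [hp 1, hp 2]
    · cases τ
      · simp [touchEdges, lo, hi]
        refine ⟨?_, ?_⟩ <;> linarith
      · simp [touchEdges, lo, hi]
        have e1 : ρ 1 * t 3 = ρ 1 * (1 - ρ 0) := by rw [e3]
        have e4 : ρ 0 * t 2 = ρ 0 * (ρ 1 + t 1) := by rw [ht2]
        have e5 : ρ 2 * t 3 = ρ 2 * (1 - ρ 0) := by rw [e3]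
        refine ⟨?_, ?_, ?_, ?_⟩ <;> linarith

end GraphDirected

/-! ### Bi-Lipschitz images -/

section BiLipschitz

open MeasureTheory

/-- `g` is bi-Lipschitz on `T` with constants `c` and `c'`. -/
structure IsBiLipschitzOn (g : ℝ → ℝ) (T : Set ℝ) (c c' : ℝ) : Prop where
  pos : 0 < c
  pos' : 0 < c'
  lower : ∀ x ∈ T, ∀ y ∈ T, c * |x - y| ≤ |g x - g y|
  upper : ∀ x ∈ T, ∀ y ∈ T, |g x - g y| ≤ c' * |x - y|

namespace IsBiLipschitzOn

variable {g : ℝ → ℝ} {T : Set ℝ} {c c' : ℝ}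

lemma mono (h : IsBiLipschitzOn g T c c') {A : Set ℝ} (hA : A ⊆ T) : IsBiLipschitzOn g A c c' :=
  ⟨h.pos, h.pos', fun x hx y hy => h.lower x (hA hx) y (hA hy),
    fun x hx y hy => h.upper x (hA hx) y (hA hy)⟩

lemma injOn (h : IsBiLipschitzOn g T c c') : Set.InjOn g T := by
  intro x hx y hy hxy
  have h1 := h.lower x hx y hy
  rw [hxy, sub_self, abs_zero] at h1
  have h2 : |x - y| ≤ 0 := nonpos_of_mul_nonpos_right h1 h.pos
  exact sub_eq_zero.1 (abs_eq_zero.1 (le_antisymm h2 (abs_nonneg _)))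

lemma lipschitzOnWith (h : IsBiLipschitzOn g T c c') : LipschitzOnWith c'.toNNReal g T :=
  LipschitzOnWith.of_dist_le_mul fun x hx y hy => by
    rw [Real.dist_eq, Real.dist_eq, Real.coe_toNNReal _ h.pos'.le]
    exact h.upper x hx y hy

lemma inverse (h : IsBiLipschitzOn g T c c') :
    IsBiLipschitzOn (Function.invFunOn g T) (g '' T) c'⁻¹ c⁻¹ where
  pos := inv_pos.2 h.pos'
  pos' := inv_pos.2 h.pos
  lower := by
    rintro _ ⟨x, hx, rfl⟩ _ ⟨y, hy, rfl⟩
    rw [h.injOn.leftInvOn_invFunOn hx, h.injOn.leftInvOn_invFunOn hy, inv_mul_le_iff₀ h.pos']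
    exact h.upper x hx y hy
  upper := by
    rintro _ ⟨x, hx, rfl⟩ _ ⟨y, hy, rfl⟩
    rw [h.injOn.leftInvOn_invFunOn hx, h.injOn.leftInvOn_invFunOn hy, ← div_eq_inv_mul,
      le_div_iff₀ h.pos, mul_comm]
    exact h.lower x hx y hy

lemma invFunOn_image (h : IsBiLipschitzOn g T c c') :
    Function.invFunOn g T '' (g '' T) = T :=
  h.injOn.leftInvOn_invFunOn.image_image

lemma hausdorffMeasure_image_ne_top (h : IsBiLipschitzOn g T c c') {s : ℝ} (hs : 0 ≤ s)
    (hT : μH[s] T ≠ ⊤) : μH[s] (g '' T) ≠ ⊤ :=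
  ne_top_of_le_ne_top (ENNReal.mul_ne_top (by finiteness) hT)
    (h.lipschitzOnWith.hausdorffMeasure_image_le hs)

lemma hausdorffMeasure_image_ne_zero (h : IsBiLipschitzOn g T c c') {s : ℝ} (hs : 0 ≤ s)
    (hT : μH[s] T ≠ 0) : μH[s] (g '' T) ≠ 0 := by
  intro h0
  have h1 := h.inverse.lipschitzOnWith.hausdorffMeasure_image_le hs
  rw [h.invFunOn_image, h0, mul_zero] at h1
  exact hT (nonpos_iff_eq_zero.1 h1)

lemma hausdorffMeasure_real_image_le (h : IsBiLipschitzOn g T c c') {s : ℝ} (hs : 0 ≤ s)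
    (hT : μH[s] T ≠ ⊤) : (μH[s]).real (g '' T) ≤ c' ^ s * (μH[s] : Measure ℝ).real T := by
  have h1 := ENNReal.toReal_mono (ENNReal.mul_ne_top (by finiteness) hT)
    (h.lipschitzOnWith.hausdorffMeasure_image_le hs)
  rwa [ENNReal.toReal_mul, ← ENNReal.toReal_rpow, ENNReal.coe_toReal,
    Real.coe_toNNReal _ h.pos'.le] at h1

end IsBiLipschitzOn

lemma IsDustSystem.hausdorffMeasure_real_iUnion {n : ℕ} {ρ : Fin n → ℝ} {Φ : Fin n → ℝ → ℝ}
    {D : Set ℝ} (h : IsDustSystem ρ Φ D) {s : ℝ} (hs : 0 ≤ s) (hD : μH[s] D ≠ ⊤)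
    (w : List (Fin n)) {L : ℕ} (S : Finset (List.Vector (Fin n) L)) :
    (μH[s]).real (⋃ u ∈ S, wordCylinder Φ D (w ++ u.1)) =
      wordProd (fun i => ρ i ^ s) w * (∑ u ∈ S, wordProd (fun i => ρ i ^ s) u.1) *
        (μH[s] : Measure ℝ).real D := by
  have hcyl : ∀ w, (μH[s]).real (wordCylinder Φ D w) =
      wordProd (fun i => ρ i ^ s) w * (μH[s] : Measure ℝ).real D := fun w => by
    rw [wordProd_rpow h.pos]
    exact hausdorffMeasure_real_image_of_scaling (wordProd_pos h.pos w) hs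
      (abs_wordMap_sub h.sim w) D
  rw [measureReal_biUnion_finset ?_ ?_ ?_]
  · simp only [hcyl, wordProd_append, Finset.mul_sum, Finset.sum_mul]
  · intro u _ v _ huv
    refine h.disjoint_cylinder (by rw [List.length_append, List.length_append, u.2, v.2]) ?_
    exact fun he => huv (Subtype.ext (List.append_cancel_left he))
  · exact fun u _ => (h.isCompact_cylinder _).measurableSet
  · exact fun u _ => ne_top_of_le_ne_top hD (measure_mono (h.cylinder_subset _))

/-- The bi-Lipschitz image of an isolated piece is a union of boundedly deep cylinders in one
cylinder, and so are, in the same cylinder, the images of its parts. -/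
lemma IsGraphDirected.exists_cylinder_decomposition {n : ℕ} {ρ : Fin n → ℝ}
    {Φ : Fin n → ℝ → ℝ} {D : Set ℝ} (hD : IsDustSystem ρ Φ D)
    {E : Bool → List (Bool × ℝ × ℝ)} {Y : Bool → Set ℝ} {κ : ℝ} (hG : IsGraphDirected E Y κ)
    {g : ℝ → ℝ} {c c' : ℝ} (hg : IsBiLipschitzOn g (Y false) c c') (hgD : g '' Y false = D) :
    ∃ L : ℕ, ∀ p, IsIsolatedPiece Y κ p → (g '' pieceSet Y p).Nontrivial →
      ∃ w, (∃ S : Finset (List.Vector (Fin n) L),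
          g '' pieceSet Y p = ⋃ u ∈ S, wordCylinder Φ D (w ++ u.1)) ∧
        ∀ k ∈ pieceKids E p, ∃ S : Finset (List.Vector (Fin n) L),
          g '' pieceSet Y k = ⋃ u ∈ S, wordCylinder Φ D (w ++ u.1) := by
  obtain ⟨r, hr0, hr1, hr⟩ := hD.exists_ratio_bound
  obtain ⟨δ, hδ0, hδ⟩ := hD.exists_separation
  obtain ⟨d, hd0, hd⟩ := hD.exists_diam_bound
  obtain ⟨θ, hθ0, hθ1, hθ⟩ : ∃ θ : ℝ, 0 < θ ∧ θ ≤ 1 ∧ ∀ τ, ∀ e ∈ E τ, θ ≤ e.2.1 := by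
    have hfin : (⋃ τ, (fun e : Bool × ℝ × ℝ => e.2.1) '' {e | e ∈ E τ}).Finite :=
      Set.finite_iUnion fun τ => (List.finite_toSet (E τ)).image _
    rcases (⋃ τ, (fun e : Bool × ℝ × ℝ => e.2.1) '' {e | e ∈ E τ}).eq_empty_or_nonempty
      with he | hne
    · refine ⟨1, one_pos, le_rfl, fun τ e heE => ?_⟩
      have : e.2.1 ∈ ⋃ τ, (fun e : Bool × ℝ × ℝ => e.2.1) '' {e | e ∈ E τ} :=
        Set.mem_iUnion.2 ⟨τ, e, heE, rfl⟩
      rw [he] at this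
      exact this.elim
    · obtain ⟨θ, hθ, hmin⟩ := Set.exists_min_image _ id hfin hne
      obtain ⟨τ, e, heE, rfl⟩ := Set.mem_iUnion.1 hθ
      exact ⟨e.2.1, hG.ratio_pos τ e heE, hG.ratio_le_one τ e heE,
        fun τ' e' he' => hmin _ (Set.mem_iUnion.2 ⟨τ', e', he', rfl⟩)⟩
  have hc := hg.pos
  have hc' := hg.pos'
  have hκ := hG.gap_pos
  -- The minimal cylinder `w` of an image satisfies `ρ_w * δ ≤ c' * r`, where `r` is the ratio of
  -- the piece. The images of the piece and its parts are isolated at distance at least `c * κ * θ *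
  -- r`. In units of `ρ_w` this is at least `c * κ * θ * δ / c'`.
  obtain ⟨L, hL⟩ := exists_pow_lt_of_lt_one
    (show 0 < c * κ * θ * δ / c' / d by positivity) hr1
  rw [lt_div_iff₀ hd0] at hL
  have hiso : ∀ q, IsIsolatedPiece Y κ q → ∀ x ∈ g '' pieceSet Y q,
      ∀ y ∈ D \ g '' pieceSet Y q, c * (κ * q.2.1) ≤ |x - y| := by
    rintro q hq _ ⟨x, hx, rfl⟩ y ⟨hyD, hy⟩
    rw [← hgD] at hyD
    obtain ⟨y, hyT, rfl⟩ := hyD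
    have hy' : y ∉ pieceSet Y q := fun h => hy (Set.mem_image_of_mem g h)
    exact (mul_le_mul_of_nonneg_left (hq.isolated x hx y ⟨hyT, hy'⟩) hc.le).trans
      (hg.lower x (hq.subset hx) y hyT)
  refine ⟨L, fun p hp hnt => ?_⟩
  obtain ⟨w, hw, _, ⟨x, hx, rfl⟩, _, ⟨y, hy, rfl⟩, hxy⟩ := hD.exists_minimal_cylinder hδ
    (by rw [← hgD]; exact Set.image_mono hp.subset) hnt
  have hpr := hp.ratio_pos
  have hscale : wordProd ρ w * δ ≤ c' * p.2.1 := by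
    refine hxy.trans ((hg.upper x (hp.subset hx) y (hp.subset hy)).trans ?_)
    refine mul_le_mul_of_nonneg_left ?_ hc'.le
    obtain ⟨x, hx, rfl⟩ := hx
    obtain ⟨y, hy, rfl⟩ := hy
    rw [add_sub_add_right_eq_sub, ← mul_sub, abs_mul, abs_of_pos hpr]
    refine mul_le_of_le_one_right hpr.le ?_
    have hx' := hG.subset_Icc _ hx
    have hy' := hG.subset_Icc _ hy
    rw [abs_le]
    constructor <;> linarith [hx'.1, hx'.2, hy'.1, hy'.2]
  have hbound : ∀ q, θ * p.2.1 ≤ q →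
      wordProd ρ w * (c * κ * θ * δ / c') ≤ c * (κ * q) := by
    intro q hq
    calc wordProd ρ w * (c * κ * θ * δ / c') = c * κ * θ * (wordProd ρ w * δ) / c' := by ring
      _ ≤ c * κ * θ * (c' * p.2.1) / c' := by gcongr
      _ = c * (κ * (θ * p.2.1)) := by field_simp
      _ ≤ c * (κ * q) := by gcongr
  refine ⟨w, ?_, fun k hk => ?_⟩
  · refine hD.eq_iUnion_cylinder hr hd hd0 hw (fun x hx y hy => ?_) hL
    exact (hbound p.2.1 (mul_le_of_le_one_left hpr.le hθ1)).trans (hiso p hp x hx y hy)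
  · refine hD.eq_iUnion_cylinder hr hd hd0
      ((Set.image_mono (hG.pieceSet_kid_subset hk)).trans hw) (fun x hx y hy => ?_) hL
    refine (hbound k.2.1 ?_).trans (hiso k (hG.isIsolatedPiece_kid hp hk) x hx y hy)
    rw [pieceKids, List.mem_map] at hk
    obtain ⟨e, he, rfl⟩ := hk
    rw [mul_comm]
    exact mul_le_mul_of_nonneg_left (hθ _ e he) hpr.le

end BiLipschitz

/-! ### The contradiction for algebraically independent weights -/

section Contradiction

open MeasureTheory MvPolynomial

/-- The scaled copy of a middle piece around its touching point. -/
def touchStep (ρ t : Fin 4 → ℝ) (p : Bool × ℝ × ℝ) : Bool × ℝ × ℝ :=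
  (true, p.2.1 * ρ 0, p.2.1 * (t 2 * (1 - ρ 0)) + p.2.2)

lemma touchStep_mem {ρ t : Fin 4 → ℝ} {p : Bool × ℝ × ℝ} (hp : p.1 = true) :
    touchStep ρ t p ∈ pieceKids (touchEdges ρ t) p := by
  simp [pieceKids, hp, touchEdges, touchStep]

lemma touchStep_iterate (ρ t : Fin 4 → ℝ) {p : Bool × ℝ × ℝ} (hp : p.1 = true) (k : ℕ) :
    ((touchStep ρ t)^[k] p).1 = true ∧ ((touchStep ρ t)^[k] p).2.1 = p.2.1 * ρ 0 ^ k := by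
  induction k with
  | zero => simp [hp]
  | succ k ih =>
    rw [Function.iterate_succ_apply']
    exact ⟨rfl, by rw [touchStep, ih.2, pow_succ, mul_assoc]⟩

/-- If two weights of nested words with equal relative weight sums differ by a power of `μ₀`,
then the outer sum contains a word in the letters `0`, `3`. -/
lemma IsDustSystem.exists_word_of_nested {ρ : Fin 4 → ℝ} {Φ : Fin 4 → ℝ → ℝ} {D : Set ℝ}
    (hD : IsDustSystem ρ Φ D) {m : Fin 4 → ℝ} (hm0 : ∀ i, 0 < m i) (hm1 : ∀ i, m i < 1)
    (h03 : m 0 = m 3) (hsum : ∑ i, m i = 1)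
    (hind : ∀ P : MvPolynomial (Fin 2) ℚ, aeval ![m 1, m 2] P = 0 → P = 0)
    {w w' : List (Fin 4)} {j L : ℕ} (hj : L < j) (hw : wordProd m w' = m 0 ^ j * wordProd m w)
    {S S' : Finset (List.Vector (Fin 4) L)} {x : ℝ}
    (hx' : x ∈ ⋃ u ∈ S', wordCylinder Φ D (w' ++ u.1))
    (hx : x ∈ ⋃ u ∈ S, wordCylinder Φ D (w ++ u.1)) :
    ∃ u ∈ S, ∀ i ∈ u.1, i = 0 ∨ i = 3 := by
  simp only [Set.mem_iUnion] at hx hx'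
  obtain ⟨u, hu, hxu⟩ := hx
  obtain ⟨u', -, hxu'⟩ := hx'
  have hxw := hD.cylinder_append_subset _ _ hxu
  have hxw' := hD.cylinder_append_subset _ _ hxu'
  have hw0 := wordProd_pos hm0 w
  have hlt : m 0 ^ j < 1 := pow_lt_one₀ (hm0 0).le (hm1 0) (by omega)
  -- If `w` properly extended `w'`, its weight could not exceed that of `w'`, which is smaller by `m
  -- 0 ^ j < 1`.
  have hle : w.length ≤ w'.length := by
    by_contra hcon
    obtain ⟨z, hz⟩ := hD.isPrefix_of_mem (not_le.1 hcon).le hxw' hxw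
    have hz1 := wordProd_le_one hm0 (fun i => (hm1 i).le) z
    rw [hz, wordProd_append] at hw hw0
    have hw0' := wordProd_pos hm0 w'
    have := wordProd_pos hm0 z
    have hpos := pow_pos (hm0 0) j
    have : m 0 ^ j * wordProd m z < 1 := by nlinarith
    nlinarith
  obtain ⟨z, rfl⟩ := hD.isPrefix_of_mem hle hxw hxw'
  have hz : wordProd m z = m 0 ^ j := by
    rw [wordProd_append, mul_comm] at hw
    exact mul_right_cancel₀ hw0.ne' hw
  have hlet := letters_of_wordProd_eq_pow h03 hsum hind hz
  have hlen : z.length = j := by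
    have h1 : ∀ z : List (Fin 4), (∀ i ∈ z, i = 0 ∨ i = 3) → wordProd m z = m 0 ^ z.length := by
      intro z hz
      refine List.prod_eq_pow_card _ _ ?_ |>.trans (by rw [List.length_map])
      intro y hy
      obtain ⟨i, hi, rfl⟩ := List.mem_map.1 hy
      rcases hz i hi with rfl | rfl
      · rfl
      · exact h03.symm
    rw [h1 z hlet] at hz
    exact (pow_right_strictAnti₀ (hm0 0) (hm1 0)).injective hz
  refine ⟨u, hu, fun i hi => hlet i ?_⟩
  -- Since `u` has length `L < j = z.length` and both cylinders contain `x`, `u` is a prefix of `z`.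
  obtain ⟨y, hy⟩ := hD.isPrefix_of_mem (u := w ++ u.1) (w := w ++ z)
    (by rw [List.length_append, List.length_append, u.2, hlen]; omega) hxu hxw'
  rw [List.append_assoc] at hy
  rw [List.append_cancel_left hy]
  exact List.mem_append_left _ hi

/-- If the touching attractor is a bi-Lipschitz preimage of a dust-like set with the same ratios,
then the two middle weights are algebraically dependent. -/
theorem exists_algebraic_relation {ρ t : Fin 4 → ℝ} {Φ : Fin 4 → ℝ → ℝ} {D T : Set ℝ}
    (hρ : IsContractionVector ρ) (h03 : ρ 0 = ρ 3) (ht : IsMiddleTouching ρ t)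
    (hT : IsAttractor (affineIFS ρ t) T) (hD : IsDustSystem ρ Φ D) {g : ℝ → ℝ} {c c' : ℝ}
    (hg : IsBiLipschitzOn g T c c') (hgD : g '' T = D) {s : ℝ} (hs : 0 < s)
    (hsum : ∑ i, ρ i ^ s = 1) :
    ∃ P : MvPolynomial (Fin 2) ℚ, P ≠ 0 ∧ aeval ![ρ 1 ^ s, ρ 2 ^ s] P = 0 := by
  by_contra hcon
  push Not at hcon
  set m : Fin 4 → ℝ := fun i => ρ i ^ s with hm
  have hind : ∀ P : MvPolynomial (Fin 2) ℚ, aeval ![m 1, m 2] P = 0 → P = 0 := fun P hP => by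
    by_contra hne
    exact hcon P hne hP
  have hm0 : ∀ i, 0 < m i := fun i => Real.rpow_pos_of_pos (hρ.pos i) s
  have hm1 : ∀ i, m i < 1 := fun i => Real.rpow_lt_one (hρ.pos i).le (hρ.lt_one i) hs
  have hm03 : m 0 = m 3 := by simp only [hm, h03]
  obtain ⟨κ, hG⟩ := exists_isGraphDirected hρ h03 ht hT
  set Y := touchSets ρ t T with hY
  set E := touchEdges ρ t with hE
  let H : Measure ℝ := μH[s]
  have hD0 := hD.hausdorffMeasure_ne_zero hs hsum
  have hDtop := hD.hausdorffMeasure_ne_top hs hsum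
  have hginv := hg.inverse
  have hTtop : H T ≠ ⊤ := by
    have := hginv.hausdorffMeasure_image_ne_top hs.le (by rwa [hgD])
    rwa [hg.invFunOn_image] at this
  have hT0 : H T ≠ 0 := by
    have := hginv.hausdorffMeasure_image_ne_zero hs.le (by rwa [hgD])
    rwa [hg.invFunOn_image] at this
  have hTpos : 0 < H.real T := ENNReal.toReal_pos hT0 hTtop
  have hDpos : 0 < H.real D := ENNReal.toReal_pos hD0 hDtop
  have hscale : ∀ p : Bool × ℝ × ℝ, 0 < p.2.1 →
      H.real (pieceSet Y p) = p.2.1 ^ s * H.real (Y p.1) := fun p hp =>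
    hausdorffMeasure_real_image_of_scaling hp hs.le
      (fun x y => by rw [add_sub_add_right_eq_sub, ← mul_sub, abs_mul, abs_of_pos hp]) _
  have hidsum : ∀ p, IsIsolatedPiece Y κ p →
      H.real (pieceSet Y p) = ((pieceKids E p).map fun k => H.real (pieceSet Y k)).sum := by
    intro p hp
    simpa using hG.measureReal_image_pieceSet H continuousOn_id (Set.injOn_id _)
      (by rw [Set.image_id]; exact hTtop) hp
  -- Obtained by subtracting the two outer parts from `T`, so the touching point needs no separate
  -- treatment.
  have hX : H.real (Y true) = (m 1 + m 2) * H.real T := by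
    have h1 := hidsum _ IsGraphDirected.isIsolatedPiece_root
    rw [hscale _ one_pos] at h1
    simp only [pieceKids, hE, touchEdges, List.map_cons, List.map_nil, List.sum_cons,
      List.sum_nil] at h1
    rw [hscale _ (by simpa using hρ.pos 0), hscale _ (by simp),
      hscale _ (by simpa using hρ.pos 0)] at h1
    simp only [one_mul, Real.one_rpow, add_zero] at h1
    rw [show Y false = T from rfl] at h1
    rw [Fin.sum_univ_four] at hsum
    have h2 : m 0 * H.real T + (H.real (Y true) + m 0 * H.real T) = H.real T := h1.symm
    have h3 : m 1 + m 2 = 1 - 2 * m 0 := by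
      have : m 0 + m 1 + m 2 + m 3 = 1 := hsum
      linarith
    rw [h3]
    linarith
  have hYpos : ∀ τ, 0 < H.real (Y τ) := by
    rintro (_ | _)
    · exact hTpos
    · rw [hX]
      exact mul_pos (add_pos (hm0 1) (hm0 2)) hTpos
  have hbpos : ∀ p, IsIsolatedPiece Y κ p → 0 < H.real (pieceSet Y p) := fun p hp => by
    rw [hscale p hp.ratio_pos]
    exact mul_pos (Real.rpow_pos_of_pos hp.ratio_pos s) (hYpos _)
  have hbtop : ∀ p, IsIsolatedPiece Y κ p → H (pieceSet Y p) ≠ ⊤ := fun p hp =>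
    ne_top_of_le_ne_top hTtop (measure_mono hp.subset)
  have hapos : ∀ p, IsIsolatedPiece Y κ p → 0 < H.real (g '' pieceSet Y p) := fun p hp => by
    have hgp := hg.mono hp.subset
    refine ENNReal.toReal_pos (hgp.hausdorffMeasure_image_ne_zero hs.le fun h0 => ?_)
      (hgp.hausdorffMeasure_image_ne_top hs.le (hbtop p hp))
    have := hbpos p hp
    rw [measureReal_def, show H (pieceSet Y p) = 0 from h0] at this
    simp at this
  have hnt : ∀ p, IsIsolatedPiece Y κ p → (g '' pieceSet Y p).Nontrivial := fun p hp => by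
    by_contra hsub
    have := Measure.nullSingletonClass_hausdorff ℝ hs
    have h0 : H (g '' pieceSet Y p) = 0 := (Set.not_nontrivial_iff.1 hsub).measure_zero _
    have := hapos p hp
    rw [measureReal_def, h0] at this
    simp at this
  have hasum : ∀ p, IsIsolatedPiece Y κ p → H.real (g '' pieceSet Y p) =
      ((pieceKids E p).map fun k => H.real (g '' pieceSet Y k)).sum := fun p hp =>
    hG.measureReal_image_pieceSet H hg.lipschitzOnWith.continuousOn hg.injOn
      (by rw [show Y false = T from rfl, hgD]; exact hDtop) hp
  -- cylinder decompositions
  obtain ⟨L, hL⟩ := hG.exists_cylinder_decomposition hD hg hgD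
  let q : Finset (List.Vector (Fin 4) L) → ℝ := fun S => ∑ u ∈ S, wordProd m u.1
  have hq : ∀ w S, H.real (⋃ u ∈ S, wordCylinder Φ D (w ++ u.1)) =
      wordProd m w * q S * H.real D := fun w S =>
    hD.hausdorffMeasure_real_iUnion hs.le hDtop w S
  -- constancy of the ratio
  let F : Set ℝ := ⋃ τ, ⋃ e ∈ {e | e ∈ E τ},
    Set.range fun S : Finset (List.Vector (Fin 4) L) × Finset (List.Vector (Fin 4) L) =>
      q S.2 / q S.1 * (H.real (Y τ) / (e.2.1 ^ s * H.real (Y e.1)))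
  have hF : F.Finite := Set.finite_iUnion fun τ =>
    (List.finite_toSet (E τ)).biUnion fun e _ => Set.finite_range _
  obtain ⟨p, hp, hconst⟩ := exists_ratio_constant (pieceKids E)
    (fun p => H.real (g '' pieceSet Y p)) (fun p => H.real (pieceSet Y p))
    (IsIsolatedPiece Y κ) ⟨_, IsGraphDirected.isIsolatedPiece_root⟩
    (fun p hp k hk => hG.isIsolatedPiece_kid hp hk) hapos hbpos hasum hidsum
    (M := c' ^ s)
    (fun p hp => (hg.mono hp.subset).hausdorffMeasure_real_image_le hs.le (hbtop p hp)) hF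
    (by
      intro p hp k hk
      obtain ⟨w, ⟨S, hS⟩, hkids⟩ := hL p hp (hnt p hp)
      obtain ⟨S', hS'⟩ := hkids k hk
      have hkp := hG.isIsolatedPiece_kid hp hk
      have h1 := hapos p hp
      have h2 := hapos k hkp
      have h3 := hbpos p hp
      have h4 := hbpos k hkp
      rw [pieceKids, List.mem_map] at hk
      obtain ⟨e, he, rfl⟩ := hk
      have he0 := hG.ratio_pos _ e he
      refine Set.mem_iUnion.2 ⟨p.1, Set.mem_iUnion₂.2 ⟨e, he, (S, S'), ?_⟩⟩
      simp only
      rw [hS, hq] at h1 ⊢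
      rw [hS', hq] at h2 ⊢
      have hw := wordProd_pos hm0 w
      rw [hscale _ hp.ratio_pos, hscale _ hkp.ratio_pos, Real.mul_rpow hp.ratio_pos.le he0.le]
      have hq1 : q S ≠ 0 := by
        rintro h0
        simp [h0] at h1
      have hr := Real.rpow_pos_of_pos hp.ratio_pos s
      have hr' := Real.rpow_pos_of_pos he0 s
      have hy1 := hYpos p.1
      have hy2 := hYpos e.1
      field_simp)
  set R := H.real (g '' pieceSet Y p) / H.real (pieceSet Y p) with hR
  have hRpos : 0 < R := div_pos (hapos p hp) (hbpos p hp)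
  -- the pieces around a touching point
  obtain ⟨p₀, hp₀, hpp₀⟩ : ∃ p₀ : Bool × ℝ × ℝ, p₀.1 = true ∧
      Relation.ReflTransGen (fun p k => k ∈ pieceKids E p) p p₀ := by
    cases hτ : p.1
    · refine ⟨(true, p.2.1 * 1, p.2.1 * 0 + p.2.2), rfl, Relation.ReflTransGen.single ?_⟩
      simp [pieceKids, hτ, hE, touchEdges]
    · exact ⟨p, hτ, Relation.ReflTransGen.refl⟩
  let ch : ℕ → Bool × ℝ × ℝ := fun k => (touchStep ρ t)^[k] p₀
  have hch1 : ∀ k, (ch k).1 = true := fun k => (touchStep_iterate ρ t hp₀ k).1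
  have hch2 : ∀ k, (ch k).2.1 = p₀.2.1 * ρ 0 ^ k := fun k => (touchStep_iterate ρ t hp₀ k).2
  have hchs : ∀ k, ch (k + 1) ∈ pieceKids E (ch k) := fun k => by
    rw [show ch (k + 1) = touchStep ρ t (ch k) from Function.iterate_succ_apply' _ _ _]
    exact touchStep_mem (hch1 k)
  have hchr : ∀ k, Relation.ReflTransGen (fun p k => k ∈ pieceKids E p) p (ch k) := by
    intro k
    induction k with
    | zero => exact hpp₀
    | succ k ih => exact ih.tail (hchs k)
  have hiso : ∀ k, IsIsolatedPiece Y κ (ch k) := fun k => (hconst _ (hchr k)).1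
  have hanti : Antitone fun k => pieceSet Y (ch k) :=
    antitone_nat_of_succ_le fun k => hG.pieceSet_kid_subset (hchs k)
  choose w hw hwk using fun k => hL (ch k) (hiso k) (hnt _ (hiso k))
  choose S hS using hw
  have hr0 : 0 < p₀.2.1 := (hiso 0).ratio_pos
  have hval : ∀ k, wordProd m (w k) * q (S k) * H.real D =
      R * (p₀.2.1 ^ s * m 0 ^ k * H.real (Y true)) := fun k => by
    rw [← hq, ← hS, (hconst _ (hchr k)).2, hscale _ (hiso k).ratio_pos, hch1, hch2,
      Real.mul_rpow hr0.le (pow_pos (hρ.pos 0) k).le, ← Real.rpow_natCast, ← Real.rpow_natCast,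
      ← Real.rpow_mul (hρ.pos 0).le, ← Real.rpow_mul (hρ.pos 0).le, mul_comm (k : ℝ) s]
  have hqpos : ∀ k, 0 < q (S k) := fun k => by
    have h1 := hapos _ (hiso k)
    rw [hS, hq] at h1
    exact pos_of_mul_pos_right (pos_of_mul_pos_left h1 hDpos.le) (wordProd_pos hm0 _).le
  obtain ⟨k₀, k₁, hk, hSS⟩ : ∃ k₀ k₁, k₀ + L < k₁ ∧ S k₀ = S k₁ := by
    -- Sampling at multiples of `L + 1` forces the two indices to differ by more than `L`.
    obtain ⟨i, j, hij, he⟩ := Finite.exists_ne_map_eq_of_infinite fun i => S (i * (L + 1))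
    have key : ∀ i j, i < j → i * (L + 1) + L < j * (L + 1) := fun i j hij => by nlinarith
    rcases lt_or_gt_of_ne hij with h | h
    · exact ⟨_, _, key i j h, he⟩
    · exact ⟨_, _, key j i h, he.symm⟩
  obtain ⟨j, rfl⟩ := Nat.exists_eq_add_of_le (show k₀ ≤ k₁ by omega)
  have hww : wordProd m (w (k₀ + j)) = m 0 ^ j * wordProd m (w k₀) := by
    have h1 := hval (k₀ + j)
    have h2 := hval k₀
    rw [← hSS, pow_add] at h1
    have h3 : wordProd m (w (k₀ + j)) * (q (S k₀) * H.real D) =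
        m 0 ^ j * wordProd m (w k₀) * (q (S k₀) * H.real D) := by
      linear_combination h1 - m 0 ^ j * h2
    exact mul_right_cancel₀ (mul_pos (hqpos _) hDpos).ne' h3
  obtain ⟨x, hx⟩ := (hnt _ (hiso (k₀ + j))).nonempty
  have hx' := Set.image_mono (f := g) (hanti (Nat.le_add_right k₀ j)) hx
  simp only [hS] at hx hx'
  obtain ⟨u, hu, hlet⟩ := hD.exists_word_of_nested hm0 hm1 hm03 hsum hind
    (by omega) hww hx hx'
  -- the left half of the annulus around the touching point
  have hkid1 : ((false, (ch k₀).2.1 * (ρ 1 * ρ 0), (ch k₀).2.1 * t 1 + (ch k₀).2.2) :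
      Bool × ℝ × ℝ) ∈ pieceKids E (ch k₀) := by
    simp [pieceKids, hch1, hE, touchEdges]
  have hkid2 : ((true, (ch k₀).2.1 * ρ 1, (ch k₀).2.1 * t 1 + (ch k₀).2.2) :
      Bool × ℝ × ℝ) ∈ pieceKids E (ch k₀) := by
    simp [pieceKids, hch1, hE, touchEdges]
  obtain ⟨S₁, hS₁⟩ := hwk k₀ _ hkid1
  obtain ⟨S₂, hS₂⟩ := hwk k₀ _ hkid2
  have hr := (hiso k₀).ratio_pos
  have e0 := (hconst _ (hchr k₀)).2
  have e1 := (hconst _ ((hchr k₀).tail hkid1)).2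
  have e2 := (hconst _ ((hchr k₀).tail hkid2)).2
  have hρ01 := mul_pos (hρ.pos 1) (hρ.pos 0)
  rw [hS, hq, hscale _ hr, hch1, hX] at e0
  rw [hS₁, hq, hscale _ (mul_pos hr hρ01), Real.mul_rpow hr.le hρ01.le,
    Real.mul_rpow (hρ.pos 1).le (hρ.pos 0).le, show Y false = T from rfl] at e1
  rw [hS₂, hq, hscale _ (mul_pos hr (hρ.pos 1)), Real.mul_rpow hr.le (hρ.pos 1).le, hX] at e2
  -- In the same units, the left half has measure `μ₁μ₀ + μ₁(μ₁ + μ₂) = μ₁(1 - μ₀)` and the whole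
  -- piece `μ₁ + μ₂`.
  have hfin : (q S₁ + q S₂) * (m 1 + m 2) = q (S k₀) * (m 1 * (1 - m 0)) := by
    have hsum' : m 0 + m 1 + m 2 + m 3 = 1 := by rw [← hsum, Fin.sum_univ_four]
    have h12 : m 1 + m 2 = 1 - 2 * m 0 := by linarith
    refine mul_left_cancel₀ (mul_pos (wordProd_pos hm0 (w k₀)) hDpos).ne' ?_
    change _ = R * ((ch k₀).2.1 ^ s * (m 1 * m 0) * H.real T) at e1
    change _ = R * ((ch k₀).2.1 ^ s * m 1 * ((m 1 + m 2) * H.real T)) at e2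
    rw [h12] at e0 e2 ⊢
    linear_combination (1 - 2 * m 0) * (e1 + e2) - (m 1 * (1 - m 0)) * e0
  exact exists_letter_of_dvd hm03 hsum hind (fun u : List.Vector (Fin 4) L => u.1) (S k₀) S₁ S₂
    hfin u hu hlet

end Contradiction

/-! ### The Moran exponent, and examples with algebraically independent weights -/

section Examples

open MeasureTheory

/-- The sum is 4 at `s = 0` and below 1 at `s = 1`. -/
lemma exists_moran_exponent {ρ : Fin 4 → ℝ} (hρ : IsContractionVector ρ) :
    ∃ s : ℝ, 0 < s ∧ ∑ i, ρ i ^ s = 1 := by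
  have hc : Continuous fun s : ℝ => ∑ i, ρ i ^ s :=
    continuous_finsetSum _ fun i _ => Real.continuous_const_rpow (hρ.pos i).ne'
  have hmem : (1 : ℝ) ∈ Set.Icc (∑ i, ρ i ^ (1 : ℝ)) (∑ i, ρ i ^ (0 : ℝ)) :=
    ⟨by simpa using hρ.sum_lt_one.le, by simp⟩
  obtain ⟨s, hs, hs1⟩ := intermediate_value_Icc' zero_le_one hc.continuousOn hmem
  refine ⟨s, lt_of_le_of_ne hs.1 ?_, hs1⟩
  rintro rfl
  simp at hs1

lemma IsDustLike.exists_isDustSystem {n : ℕ} {ρ : Fin n → ℝ} {D : Set ℝ}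
    (hρ : IsContractionVector ρ) (hD : IsDustLike ρ D) : ∃ Φ, IsDustSystem ρ Φ D := by
  obtain ⟨Φ, hsim, hattr, hdisj⟩ := hD
  exact ⟨Φ, hρ.pos, hρ.lt_one, hsim, hattr, hdisj⟩

/-- If a dust-like set is Lipschitz equivalent to the touching attractor, then both have the Moran
exponent as dimension, and the two middle weights are algebraically dependent. -/
lemma dimH_eq_and_dependent {ρ t : Fin 4 → ℝ} {D T : Set ℝ} (hρ : IsContractionVector ρ)
    (h03 : ρ 0 = ρ 3) (ht : IsMiddleTouching ρ t) (hD : IsDustLike ρ D)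
    (hT : IsAttractor (affineIFS ρ t) T) (hDT : LipschitzEquivalent D T) {s : ℝ≥0}
    (hs : (0 : ℝ) < s) (hsum : ∑ i, ρ i ^ (s : ℝ) = 1) :
    dimH D = s ∧ dimH T = s ∧ ∃ P : MvPolynomial (Fin 2) ℚ, P ≠ 0 ∧
      MvPolynomial.aeval ![ρ 1 ^ (s : ℝ), ρ 2 ^ (s : ℝ)] P = 0 := by
  obtain ⟨Φ, hΦ⟩ := hD.exists_isDustSystem hρ
  obtain ⟨f, hf, c, c', hc, hc', hfc⟩ := hDT
  have hbl : IsBiLipschitzOn f D c c' :=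
    ⟨hc, hc', fun x hx y hy => (hfc x hx y hy).1, fun x hx y hy => (hfc x hx y hy).2⟩
  have h0 := hΦ.hausdorffMeasure_ne_zero hs hsum
  have htop := hΦ.hausdorffMeasure_ne_top hs hsum
  have h0' := hbl.hausdorffMeasure_image_ne_zero hs.le h0
  have htop' := hbl.hausdorffMeasure_image_ne_top hs.le htop
  have hinv := hbl.inverse
  have himg := hbl.invFunOn_image
  rw [hf.image_eq] at h0' htop' hinv himg
  exact ⟨dimH_of_hausdorffMeasure_ne_zero_ne_top h0 htop,
    dimH_of_hausdorffMeasure_ne_zero_ne_top h0' htop',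
    exists_algebraic_relation hρ h03 ht hT hΦ hinv himg hs hsum⟩

/-- Only countably many reals are algebraic over `ℚ`, or over the countable ring `ℚ[x]`, so both
choices avoid a countable set. -/
lemma exists_algebraicallyIndependent_pair {a b : ℝ} (hab : a < b) :
    ∃ x ∈ Set.Ioo a b, ∃ y ∈ Set.Ioo a b,
      ∀ P : MvPolynomial (Fin 2) ℚ, MvPolynomial.aeval ![x, y] P = 0 → P = 0 := by
  have hex : ∀ s : Set ℝ, s.Countable → ∃ x ∈ Set.Ioo a b, x ∉ s := by
    intro s hs
    obtain ⟨x, hx, hx'⟩ := (hs.dense_compl ℝ).exists_between hab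
    exact ⟨x, hx', hx⟩
  obtain ⟨x, hx, hxt⟩ := hex _ (Algebraic.countable ℚ ℝ)
  have hxi : AlgebraicIndependent ℚ fun _ : Unit => x :=
    algebraicIndependent_unique_type_iff.2 hxt
  have hK : Countable (Algebra.adjoin ℚ (Set.range fun _ : Unit => x)) := by
    rw [← Cardinal.mk_le_aleph0_iff]
    refine (Algebra.cardinalMk_adjoin_le ℚ _).trans ?_
    simp
  obtain ⟨y, hy, hyt⟩ := hex _
    (Algebraic.countable (Algebra.adjoin ℚ (Set.range fun _ : Unit => x)) ℝ)
  refine ⟨x, hx, y, hy, fun P hP => ?_⟩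
  have hind := (hxi.option_iff_transcendental y).2 hyt
  let e : Fin 2 → Option Unit := ![some (), none]
  have he : Function.Injective e := by decide
  have hcomp : (fun o : Option Unit => o.elim y fun _ => x) ∘ e = ![x, y] := by
    funext i
    fin_cases i <;> rfl
  have h := hind.comp e he
  rw [hcomp] at h
  exact (injective_iff_map_eq_zero _).1 (algebraicIndependent_iff_injective_aeval.1 h) P hP

lemma exists_isDustLike {ρ : Fin 4 → ℝ} (hρ : IsContractionVector ρ) : ∃ D, IsDustLike ρ D := by
  have hp := hρ.pos
  have hsum := hρ.sum_lt_one
  rw [Fin.sum_univ_four] at hsum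
  obtain ⟨e, he⟩ : ∃ e, e = (1 - (ρ 0 + ρ 1 + ρ 2 + ρ 3)) / 3 := ⟨_, rfl⟩
  have he0 : 0 < e := by rw [he]; linarith
  let t : Fin 4 → ℝ :=
    ![0, ρ 0 + e, ρ 0 + ρ 1 + 2 * e, ρ 0 + ρ 1 + ρ 2 + 3 * e]
  obtain ⟨i₀, hi₀⟩ := Finite.exists_max ρ
  have hmaps : ∀ i, Set.MapsTo (affineIFS ρ t i) (Set.Icc 0 1) (Set.Icc (t i) (t i + ρ i)) := by
    intro i x hx
    have := hp i
    constructor <;> simp only [affineIFS] <;> nlinarith [hx.1, hx.2]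
  have hsub : ∀ i, Set.Icc (t i) (t i + ρ i) ⊆ Set.Icc (0 : ℝ) 1 := by
    intro i
    refine Set.Icc_subset_Icc ?_ ?_ <;> fin_cases i <;> simp [t] <;>
      linarith [hp 0, hp 1, hp 2, hp 3]
  have hsim : ∀ i, IsSimilitude (ρ i) (affineIFS ρ t i) := fun i x y => by
    simp only [affineIFS]
    rw [add_sub_add_right_eq_sub, ← mul_sub, abs_mul, abs_of_pos (hp i)]
  obtain ⟨D, hD, hDI⟩ := exists_isAttractor (affineIFS ρ t) (hp i₀).le (hρ.lt_one i₀)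
    (fun i x y => by rw [hsim i x y]; exact mul_le_mul_of_nonneg_right (hi₀ i) (abs_nonneg _))
    isClosed_Icc (Set.nonempty_Icc.2 zero_le_one) (fun i => (hmaps i).mono_right (hsub i))
  have hlt : ∀ i j, i < j → t i + ρ i < t j := by
    intro i j hij
    fin_cases i <;> fin_cases j <;> simp at hij <;> simp [t] <;> linarith [hp 1, hp 2]
  have hdisj : ∀ i j, i < j → Disjoint (affineIFS ρ t i '' D) (affineIFS ρ t j '' D) := by
    intro i j hij
    rw [Set.disjoint_left]
    rintro _ ⟨x, hx, rfl⟩ ⟨y, hy, hxy⟩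
    have h1 := (hmaps i (hDI hx)).2
    have h2 := (hmaps j (hDI hy)).1
    linarith [hlt i j hij]
  refine ⟨D, affineIFS ρ t, hsim, hD, fun i j hij => ?_⟩
  rcases lt_or_gt_of_ne hij with h | h
  · exact hdisj i j h
  · exact (hdisj j i h).symm

lemma exists_isMiddleTouching {ρ : Fin 4 → ℝ} (hρ : IsContractionVector ρ) :
    ∃ t T, IsTouchingIFS ρ t ∧ touchingLetters ρ t = {1} ∧ IsAttractor (affineIFS ρ t) T := by
  have hp := hρ.pos
  have hsum := hρ.sum_lt_one
  rw [Fin.sum_univ_four] at hsum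
  -- The unused length is shared equally by the two gaps on either side of the touching pair.
  obtain ⟨e, he⟩ : ∃ e, e = (1 - (ρ 0 + ρ 1 + ρ 2 + ρ 3)) / 2 := ⟨_, rfl⟩
  have he0 : 0 < e := by rw [he]; linarith
  let t : Fin 4 → ℝ :=
    ![0, ρ 0 + e, ρ 0 + ρ 1 + e, ρ 0 + ρ 1 + ρ 2 + 2 * e]
  have htl : touchingLetters ρ t = {1} := by
    ext i
    simp only [touchingLetters, affineIFS, Set.mem_ofPred_eq, Set.mem_singleton_iff]
    constructor
    · rintro ⟨j, hj, hij⟩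
      fin_cases i <;> fin_cases j <;> simp at hj <;> simp [t] at hij ⊢ <;> linarith
    · rintro rfl
      exact ⟨2, rfl, by simp [t]; ring⟩
  obtain ⟨i₀, hi₀⟩ := Finite.exists_max ρ
  obtain ⟨T, hT, -⟩ := exists_isAttractor (affineIFS ρ t) (hp i₀).le (hρ.lt_one i₀)
    (fun i x y => by
      simp only [affineIFS]
      rw [add_sub_add_right_eq_sub, ← mul_sub, abs_mul, abs_of_pos (hp i)]
      exact mul_le_mul_of_nonneg_right (hi₀ i) (abs_nonneg _))
    (isClosed_Icc (a := (0 : ℝ)) (b := 1)) (Set.nonempty_Icc.2 zero_le_one) (by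
      intro i x hx
      have h1 : 0 ≤ t i ∧ t i + ρ i ≤ 1 := by
        constructor <;> fin_cases i <;> simp [t] <;> linarith [hp 0, hp 1, hp 2, hp 3]
      have := hp i
      constructor <;> simp only [affineIFS] <;> nlinarith [hx.1, hx.2])
  refine ⟨t, T, ⟨?_, ?_, ?_, by rw [htl]; exact Set.singleton_nonempty 1⟩, htl, hT⟩
  · intro i j hij
    fin_cases i <;> fin_cases j <;> simp at hij <;> simp [t, affineIFS] <;>
      linarith [hp 0, hp 1, hp 2, hp 3]
  · intro i hi
    fin_cases i <;> simp at hi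
    simp [t, affineIFS]
  · intro i hi
    fin_cases i <;> simp at hi
    simp [t, affineIFS]
    linarith

/-- There are contraction vectors with algebraically independent middle weights. -/
lemma exists_independent_contractionVector : ∃ ρ : Fin 4 → ℝ, IsContractionVector ρ ∧
    ρ 0 = ρ 3 ∧ ∑ i, ρ i ^ ((1 / 2 : ℝ≥0) : ℝ) = 1 ∧
    ∀ P : MvPolynomial (Fin 2) ℚ,
      MvPolynomial.aeval ![ρ 1 ^ ((1 / 2 : ℝ≥0) : ℝ), ρ 2 ^ ((1 / 2 : ℝ≥0) : ℝ)] P = 0 →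
        P = 0 := by
  obtain ⟨x, hx, y, hy, hind⟩ :=
    exists_algebraicallyIndependent_pair (show (0 : ℝ) < 1 / 2 by norm_num)
  -- The weights come first; with `ρ = m ^ 2` the exponent is `1 / 2`, and `m i ^ 2 < m i` gives `∑
  -- ρ i < 1`.
  let m : Fin 4 → ℝ := ![(1 - x - y) / 2, x, y, (1 - x - y) / 2]
  have hm : ∀ i, 0 < m i ∧ m i < 1 := by
    intro i
    constructor <;> fin_cases i <;> simp [m] <;> linarith [hx.1, hx.2, hy.1, hy.2]
  have hms : ∑ i, m i = 1 := by
    rw [Fin.sum_univ_four]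
    simp [m]
    ring
  have hrt : ∀ i, (m i ^ 2) ^ ((1 / 2 : ℝ≥0) : ℝ) = m i := fun i => by
    rw [NNReal.coe_div, NNReal.coe_one, NNReal.coe_ofNat, ← Real.sqrt_eq_rpow,
      Real.sqrt_sq (hm i).1.le]
  refine ⟨fun i => m i ^ 2, ⟨fun i => pow_pos (hm i).1 2,
    fun i => pow_lt_one₀ (hm i).1.le (hm i).2 two_ne_zero, ?_⟩, rfl, ?_, ?_⟩
  · rw [← hms]
    refine Finset.sum_lt_sum_of_nonempty Finset.univ_nonempty fun i _ => ?_
    nlinarith [hm i]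
  · simp only [hrt, hms]
  · simp only [hrt]
    exact hind

end Examples

theorem theorem1p2 :
    (∀ (ρ t : Fin 4 → ℝ) (D T : Set ℝ),
      IsContractionVector ρ → ρ 0 = ρ 3 →
      IsTouchingIFS ρ t → touchingLetters ρ t = {1} →
      IsDustLike ρ D → IsAttractor (affineIFS ρ t) T →
      LipschitzEquivalent D T →
        ∃ s : ℝ≥0, dimH D = s ∧ dimH T = s ∧
          ∃ P : MvPolynomial (Fin 2) ℚ, P ≠ 0 ∧
            MvPolynomial.aeval ![ρ 1 ^ (s : ℝ), ρ 2 ^ (s : ℝ)] P = 0) ∧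
    (∃ (ρ t : Fin 4 → ℝ) (T : Set ℝ),
      IsContractionVector ρ ∧ ρ 0 = ρ 3 ∧
      (∃ q : ℚ, Real.log (ρ 0) / Real.log (ρ 3) = q) ∧
      IsTouchingIFS ρ t ∧ touchingLetters ρ t = {1} ∧
      IsAttractor (affineIFS ρ t) T ∧
      (∃ D : Set ℝ, IsDustLike ρ D) ∧
      ∀ D : Set ℝ, IsDustLike ρ D → ¬ LipschitzEquivalent D T) := by
  constructor
  · intro ρ t D T hρ h03 ht hletters hD hT hDT
    obtain ⟨s, hs, hsum⟩ := exists_moran_exponent hρ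
    lift s to ℝ≥0 using hs.le
    exact ⟨s, dimH_eq_and_dependent hρ h03 (isMiddleTouching ht hletters) hD hT hDT hs hsum⟩
  · obtain ⟨ρ, hρ, h03, hsum, hind⟩ := exists_independent_contractionVector
    obtain ⟨t, T, ht, hletters, hT⟩ := exists_isMiddleTouching hρ
    refine ⟨ρ, t, T, hρ, h03, ⟨1, ?_⟩, ht, hletters, hT, exists_isDustLike hρ, ?_⟩
    · rw [h03, div_self (Real.log_neg (hρ.pos 3) (hρ.lt_one 3)).ne, Rat.cast_one]
    · intro D hD hDT
      obtain ⟨-, -, P, hP, hP0⟩ := dimH_eq_and_dependent hρ h03 (isMiddleTouching ht hletters)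
        hD hT hDT (by norm_num) hsum
      exact hP (hind P hP0)
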